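/- Setting. For each $T\in\mathbb N$ let the random vectors $(\theta_i,\varepsilon_{i,T})$, $i=1,2,\dots$, be independent and identically distributed over $i$ (no restriction on the dependence between $\theta_i$ and $\varepsilon_{i,T}$); let $F$ be the cdf of $\theta_i$ and $G_T$ the cdf of $\varepsilon_{i,T}$. Fix $p>0$, put $\vartheta_{i,T}=\theta_i+T^{-p}\varepsilon_{i,T}$, and let $\vartheta_{1,N,T}\le\dots\le\vartheta_{N,N,T}$ be the order statistics of $\vartheta_{1,T},\dots,\vartheta_{N,T}$, and $\theta_{N,N}=\max\{\theta_1,\dots,\theta_N\}$. For a cdf $H$ let $H^{-1}(r)=\inf\{x: H(x)\ge r\}$ for $0<r\le 1$ (so $H^{-1}(1)\in(-\infty,\infty]$ is the right endpoint), and let $H^{-1}(0)=\inf\{x:H(x)>0\}\in[-\infty,\infty)$ be the left endpoint. "As $N,T\to\infty$" refers throughout to one and the same fixed mode in which both $N$ and $T$ tend to infinity (for instance along a sequence $(N_k,T_k)$, or as a double limit); $\Rightarrow$ denotes convergence in distribution. Assumptions. (i) There are constants $a_N\neq 0$, $b_N$ and a non-degenerate random variable $X$ with $(\theta_{N,N}-b_N)/a_N\Rightarrow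 X$ as $N\to\infty$. (ii) (Tail equivalence) For each $\tau\in(0,\infty)$ there is $\epsilon\in(0,1)$ such that, as $N,T\to\infty$, $$\sup_{u\in[0,\epsilon]}\frac1{a_N}\Big(F^{-1}\big(1-\tfrac1{N\tau}-u\big)-F^{-1}\big(1-\tfrac1{N\tau}\big)+\tfrac1{T^p}G_T^{-1}(u)\Big)\to0,$$ $$\inf_{u\in[0,\frac1{N\tau}]}\frac1{a_N}\Big(F^{-1}\big(1-\tfrac1{N\tau}+u\big)-F^{-1}\big(1-\tfrac1{N\tau}\big)+\tfrac1{T^p}G_T^{-1}(1-u)\Big)\to0 .$$ (iii) $F$ is in the domain of attraction of the extreme value distribution with index $\gamma\in\mathbb R$, i.e. there are $\alpha_N>0$, $\beta_N$ with $F(\alpha_Nx+\beta_N)^N\to\exp\!\big(-(1+\gamma x)^{-1/\gamma}\big)$ for all $x$ with $1+\gamma x>0$ (read as $\exp(-e^{-x})$ for all $x$ if $\gamma=0$), and with limit $0$ (if $\gamma>0$) or $1$ (if $\gamma<0$) for the other $x$. Let $q\ge0$ be a fixed integer and $E_1^*,\dots,E_{q+1}^*$ iid standard exponential random variables; write $S_j=E_1^*+\dots+E_j^*$.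 Then, as $N,T\to\infty$: (1) if $\gamma>0$, $$\Big(\frac{\vartheta_{N,N,T}}{F^{-1}(1-1/N)},\frac{\vartheta_{N-1,N,T}}{F^{-1}(1-1/N)},\dots,\frac{\vartheta_{N-q,N,T}}{F^{-1}(1-1/N)}\Big)\Rightarrow\big(S_1^{-\gamma},S_2^{-\gamma},\dots,S_{q+1}^{-\gamma}\big);$$ (2) if $\gamma=0$, there is a function $\hat f:\mathbb R\to(0,\infty)$, depending only on $F$, such that for every $x>0$ $$\frac{F^{-1}(1-\frac1{Nx})-F^{-1}(1-\frac1N)}{\hat f\big(F^{-1}(1-\frac1N)\big)}\to\log x\quad(N\to\infty),$$ and for every such $\hat f$ $$\Big(\frac{\vartheta_{N,N,T}-F^{-1}(1-\frac1N)}{\hat f(F^{-1}(1-\frac1N))},\dots,\frac{\vartheta_{N-q,N,T}-F^{-1}(1-\frac1N)}{\hat f(F^{-1}(1-\frac1N))}\Big)\Rightarrow\big(-\log S_1,\dots,-\log S_{q+1}\big);$$ (3) if $\gamma<0$, then $F^{-1}(1)<\infty$ and $$\Big(\frac{\vartheta_{N,N,T}-F^{-1}(1)}{F^{-1}(1)-F^{-1}(1-1/N)},\dots,\frac{\vartheta_{N-q,N,T}-F^{-1}(1)}{F^{-1}(1)-F^{-1}(1-1/N)}\Big)\Rightarrow\big(-S_1^{-\gamma},\dots,-S_{q+1}^{-\gamma}\big).$$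 -/

import Mathlib

open MeasureTheory ProbabilityTheory Filter Topology

noncomputable section

/-- The quantile function `F⁻¹ : [0, 1] → [-∞, ∞]` of a probability distribution `F` on `ℝ`, where
the cdf is also written `F`. For `0 < r ≤ 1` it is `inf {x | r ≤ F x}` (the left-continuous inverse,
with `inf ∅ = ∞`); in particular `F⁻¹(1)` is the right endpoint of `F`, possibly `∞`. At `0` it is
the left endpoint `inf {x | 0 < F x}` of `F`, possibly `-∞`. -/
def quantile (F : Measure ℝ) (r : ℝ) : EReal :=
  ⨅ x ∈ {x : ℝ | r ≤ cdf F x ∧ 0 < cdf F x}, (x : EReal)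

/-- For a sample `x` of size `N` with order statistics `x_{1,N} ≤ ⋯ ≤ x_{N,N}`, this is the
`k`-th one from the top, `x_{N-k,N}` for `0 ≤ k < N` (and the default value `0` if `N ≤ k`). -/
def topOrderStat (N : ℕ) (x : Fin N → ℝ) (k : ℕ) : ℝ :=
  if h : k < N then x (Tuple.sort x (Fin.rev ⟨k, h⟩)) else 0

/-- The cdf `exp (-(1 + γ x)^(-1/γ))`, `1 + γ x > 0`, of the extreme value distribution with extreme
value index `γ`; it is `exp (-exp (-x))` for `γ = 0`. -/
def gevCdf (γ x : ℝ) : ℝ :=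
  if γ = 0 then Real.exp (-Real.exp (-x))
  else if 0 < 1 + γ * x then Real.exp (-(1 + γ * x) ^ (-1 / γ))
  else if 0 < γ then 0 else 1

/-- `F` is in the (weak) domain of attraction of the extreme value distribution with extreme value
index `γ`: for suitable constants, the normalized maximum of `N` independent draws from `F`, whose
cdf at `x` is `F (α N * x + β N) ^ N`, converges in distribution to it. -/
def InDomainOfAttraction (F : Measure ℝ) (γ : ℝ) : Prop :=
  ∃ α β : ℕ → ℝ, (∀ N, 0 < α N) ∧
    ∀ x : ℝ, Tendsto (fun N : ℕ => cdf F (α N * x + β N) ^ N) atTop (𝓝 (gevCdf γ x))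

/-- `f` is a positive auxiliary (scale) function for `F` with extreme value index `0`: with
`U N = F⁻¹(1 - 1/N)`, the ratio `(U (N x) - U N) / f (U N)` tends to `log x` for each `x > 0`. -/
def IsAuxiliaryFunction (F : Measure ℝ) (f : ℝ → ℝ) : Prop :=
  (∀ t, 0 < f t) ∧
    ∀ x : ℝ, 0 < x →
      Tendsto (fun N : ℕ =>
        ((quantile F (1 - 1 / (N * x))).toReal - (quantile F (1 - 1 / N)).toReal) /
          f (quantile F (1 - 1 / N)).toReal) atTop (𝓝 (Real.log x))

/-- The supremum over `u ∈ [0, ε]` of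
`a⁻¹ (F⁻¹(1 - 1/(Nτ) - u) - F⁻¹(1 - 1/(Nτ)) + T⁻ᵖ G⁻¹(u))`. -/
def tailSup (F G : Measure ℝ) (a p τ ε : ℝ) (N T : ℕ) : EReal :=
  ⨆ u ∈ Set.Icc (0 : ℝ) ε,
    ((1 / a : ℝ) : EReal) *
      (quantile F (1 - 1 / (N * τ) - u) - quantile F (1 - 1 / (N * τ)) +
        ((1 / (T : ℝ) ^ p : ℝ) : EReal) * quantile G u)

/-- The infimum over `u ∈ [0, 1/(Nτ)]` of
`a⁻¹ (F⁻¹(1 - 1/(Nτ) + u) - F⁻¹(1 - 1/(Nτ)) + T⁻ᵖ G⁻¹(1 - u))`. -/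
def tailInf (F G : Measure ℝ) (a p τ : ℝ) (N T : ℕ) : EReal :=
  ⨅ u ∈ Set.Icc (0 : ℝ) (1 / (N * τ)),
    ((1 / a : ℝ) : EReal) *
      (quantile F (1 - 1 / (N * τ) + u) - quantile F (1 - 1 / (N * τ)) +
        ((1 / (T : ℝ) ^ p : ℝ) : EReal) * quantile G (1 - u))

/-- The order statistic `ϑ_{N-k,N,T}` of the noisy observations `ϑ_{i,T} = θ_i + ε_{i,T} / T^p`
of the first `N` units; `ε T i` is `ε_{i,T}`. -/
def noisyTop {Ω : Type*} (θ : ℕ → Ω → ℝ) (ε : ℕ → ℕ → Ω → ℝ) (p : ℝ) (N T k : ℕ) (ω : Ω) : ℝ :=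
  topOrderStat N (fun i : Fin N => θ i ω + 1 / (T : ℝ) ^ p * ε T i ω) k

end

/-! Write U(t) for the quantile F⁻¹(1 - 1/t). Inverting the domain of attraction condition gives
(U(Nx) - β_N)/α_N → `gevQuantile γ x` for every x > 0 (`tendsto_tailQuantile_sub_div`), so
everything can be argued with quantiles of a single observation.

The noise is controlled without any knowledge of the dependence between θ and ε. Makarov's bounds
(`add_le_quantile_add`, `quantile_add_le_add`) sandwich a quantile of the sum between combinations
of marginal quantiles, and these are exactly the expressions in the tail equivalence assumption.
Hence noise shifts the quantile at 1 - 1/(Nτ) by o(a_N). Moreover a_N = O(α_N): the noiseless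
maximum is tight in the scale α_N and has a nondegenerate limit in the scale a_N
(`exists_abs_le_mul_of_tendstoInDistribution`). So the noisy quantiles have the same normalized
limits as U.

Convergence of quantiles gives joint convergence of the top order statistics
(`tendstoInDistribution_topOrderStat`). The observations are decreasing functions of iid uniforms on
(0, N). The q + 1 smallest of these uniforms have, on the increasing cone, the density N(N-1)⋯(N-q)
N^{-(q+1)} (1 - w_last/N)^{N-q-1}. It tends to exp(-w_last), the density of the exponential partial
sums, and dominated convergence applies to each bounded continuous test function.

It remains to compare α_N with the three explicit scales. For γ > 0, U(N)/α_N → 1/γ by a recursion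
under halving N. For γ < 0, the increments of U over successive doublings decay geometrically, which
makes the right endpoint finite and locates it. For γ = 0, an auxiliary function is built from
increments of U over a factor e. -/

open scoped ENNReal

/-! ### Quantiles and the tail quantile function. -/

section Quantile

lemma quantile_mono (F : Measure ℝ) : Monotone (quantile F) := by
  intro r s hrs
  refine le_iInf₂ fun x hx => iInf₂_le x ⟨hrs.trans hx.1, hx.2⟩

/-- Strictly between 0 and 1 the clause `0 < cdf F x` is automatic. The limits of the cdf at ±∞ make
the infimum finite, and right continuity makes it attained, which yields the Galois connection. -/
lemma exists_quantile_eq_coe (F : Measure ℝ) {r : ℝ} (h0 : 0 < r) (h1 : r < 1) :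
    ∃ q : ℝ, quantile F r = q ∧ ∀ x, q ≤ x ↔ r ≤ cdf F x := by
  set S : Set ℝ := {x | r ≤ cdf F x} with hS
  have hne : S.Nonempty := by
    obtain ⟨x, hx⟩ := ((tendsto_cdf_atTop F).eventually (lt_mem_nhds h1)).exists
    exact ⟨x, hx.le⟩
  have hbdd : BddBelow S := by
    obtain ⟨y, hy⟩ := ((tendsto_cdf_atBot F).eventually (gt_mem_nhds h0)).exists
    refine ⟨y, fun x hx => ?_⟩
    by_contra! hlt
    exact absurd ((hx : r ≤ cdf F x).trans (monotone_cdf F hlt.le)) (not_le.2 hy)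
  have hmem : r ≤ cdf F (sInf S) := by
    have hc : Tendsto (cdf F) (𝓝[>] (sInf S)) (𝓝 (cdf F (sInf S))) :=
      ((cdf F).right_continuous (sInf S)).mono_left (nhdsWithin_mono _ Set.Ioi_subset_Ici_self)
    refine ge_of_tendsto hc ?_
    filter_upwards [self_mem_nhdsWithin] with y hy
    obtain ⟨z, hz, hzy⟩ := exists_lt_of_csInf_lt hne hy
    exact (hz : r ≤ cdf F z).trans (monotone_cdf F hzy.le)
  refine ⟨sInf S, ?_, fun x => ⟨fun h => hmem.trans (monotone_cdf F h), fun h => csInf_le hbdd h⟩⟩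
  apply le_antisymm
  · exact iInf₂_le (sInf S) ⟨hmem, h0.trans_le hmem⟩
  · exact le_iInf₂ fun x hx => EReal.coe_le_coe_iff.2 (csInf_le hbdd hx.1)

lemma coe_toReal_quantile (F : Measure ℝ) {r : ℝ} (h0 : 0 < r) (h1 : r < 1) :
    ((quantile F r).toReal : EReal) = quantile F r := by
  obtain ⟨q, hq, -⟩ := exists_quantile_eq_coe F h0 h1
  rw [hq, EReal.toReal_coe]

lemma toReal_quantile_le_iff (F : Measure ℝ) {r : ℝ} (h0 : 0 < r) (h1 : r < 1) {x : ℝ} :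
    (quantile F r).toReal ≤ x ↔ r ≤ cdf F x := by
  obtain ⟨q, hq, h⟩ := exists_quantile_eq_coe F h0 h1
  rw [hq, EReal.toReal_coe, h]

lemma quantile_one_ne_bot (F : Measure ℝ) : quantile F 1 ≠ ⊥ := by
  have h := quantile_mono F (show (1 / 2 : ℝ) ≤ 1 by norm_num)
  rw [← coe_toReal_quantile F (by norm_num) (by norm_num)] at h
  exact fun hb => by simp [hb] at h

/-- The tail quantile function `t ↦ F⁻¹(1 - 1/t)`. -/
noncomputable def tailQuantile (F : Measure ℝ) (t : ℝ) : ℝ := (quantile F (1 - 1 / t)).toReal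

lemma one_sub_one_div_mem {t : ℝ} (ht : 1 < t) : 0 < 1 - 1 / t ∧ 1 - 1 / t < 1 := by
  have h : 1 / t < 1 := by rw [div_lt_one (by linarith)]; exact ht
  have h' : 0 < 1 / t := by positivity
  constructor <;> linarith

lemma coe_tailQuantile (F : Measure ℝ) {t : ℝ} (ht : 1 < t) :
    (tailQuantile F t : EReal) = quantile F (1 - 1 / t) :=
  coe_toReal_quantile F (one_sub_one_div_mem ht).1 (one_sub_one_div_mem ht).2

lemma tailQuantile_le_iff (F : Measure ℝ) {t : ℝ} (ht : 1 < t) {x : ℝ} :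
    tailQuantile F t ≤ x ↔ 1 - 1 / t ≤ cdf F x :=
  toReal_quantile_le_iff F (one_sub_one_div_mem ht).1 (one_sub_one_div_mem ht).2

lemma tailQuantile_mono (F : Measure ℝ) {s t : ℝ} (hs : 1 < s) (hst : s ≤ t) :
    tailQuantile F s ≤ tailQuantile F t := by
  rw [tailQuantile_le_iff F hs]
  refine le_trans ?_ ((tailQuantile_le_iff F (hs.trans_le hst)).1 le_rfl)
  gcongr

end Quantile

/-! ### From convergence of maxima to convergence of tail quantiles. -/

section ExtremeValue

/-- The limit `(x ^ γ - 1) / γ` (`log x` if `γ = 0`) of the normalized increments of the tail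
quantile function. -/
noncomputable def gevQuantile (γ x : ℝ) : ℝ := if γ = 0 then Real.log x else (x ^ γ - 1) / γ

lemma gevQuantile_one (γ : ℝ) : gevQuantile γ 1 = 0 := by simp [gevQuantile]

lemma one_add_mul_gevQuantile {γ : ℝ} (hγ : γ ≠ 0) (x : ℝ) :
    1 + γ * gevQuantile γ x = x ^ γ := by
  simp only [gevQuantile, if_neg hγ]; field_simp; ring

/-- Evaluating the limit cdf only at points `gevQuantile γ x` avoids its degenerate branches and
treats all signs of γ at once. -/
lemma gevCdf_gevQuantile (γ : ℝ) {x : ℝ} (hx : 0 < x) :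
    gevCdf γ (gevQuantile γ x) = Real.exp (-1 / x) := by
  by_cases hγ : γ = 0
  · simp [gevCdf, gevQuantile, hγ, Real.exp_neg, Real.exp_log hx, neg_div]
  · rw [gevCdf, if_neg hγ, one_add_mul_gevQuantile hγ, if_pos (by positivity), ← Real.rpow_mul hx.le,
      mul_div_cancel₀ _ hγ, Real.rpow_neg_one, neg_div, one_div]

lemma continuousAt_gevQuantile (γ : ℝ) {x : ℝ} (hx : 0 < x) : ContinuousAt (gevQuantile γ) x := by
  unfold gevQuantile
  by_cases hγ : γ = 0
  · simpa [hγ] using Real.continuousAt_log hx.ne'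
  · simp only [hγ, if_false]
    exact ((Real.continuousAt_rpow_const x γ (Or.inl hx.ne')).sub continuousAt_const).div_const γ

lemma gevQuantile_lt {γ x y : ℝ} (hx : 0 < x) (hxy : x < y) :
    gevQuantile γ x < gevQuantile γ y := by
  unfold gevQuantile
  rcases lt_trichotomy γ 0 with h | h | h
  · simp only [h.ne, if_false]
    have := Real.rpow_lt_rpow_of_neg hx hxy h
    exact div_lt_div_of_neg_of_lt h (by linarith)
  · simp only [h, if_true]
    exact Real.log_lt_log hx hxy
  · simp only [h.ne', if_false]
    have := Real.rpow_lt_rpow hx.le hxy h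
    gcongr

variable {F : Measure ℝ} {γ : ℝ} {α β : ℕ → ℝ}

lemma tendsto_one_sub_one_div_mul_pow (x : ℝ) :
    Tendsto (fun N : ℕ => (1 - 1 / (N * x)) ^ N) atTop (𝓝 (Real.exp (-1 / x))) := by
  refine (Real.tendsto_one_add_div_pow_exp (-1 / x)).congr fun N => ?_
  congr 1
  by_cases hx : x = 0
  · simp [hx]
  by_cases hN : (N : ℝ) = 0
  · simp [hN]
  · field_simp; ring

lemma tendsto_natCast_mul_const_atTop {x : ℝ} (hx : 0 < x) :
    Tendsto (fun N : ℕ => (N : ℝ) * x) atTop atTop :=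
  tendsto_natCast_atTop_atTop.atTop_mul_const hx

lemma exp_neg_one_div_lt {x y : ℝ} (hx : 0 < x) (hxy : x < y) :
    Real.exp (-1 / x) < Real.exp (-1 / y) := by
  rw [Real.exp_lt_exp, neg_div, neg_div, neg_lt_neg_iff]
  exact one_div_lt_one_div_of_lt hx hxy

/-- The tail quantile function of a distribution in a domain of attraction, normalized by the
constants of the maximum, converges. -/
lemma tendsto_tailQuantile_sub_div (hα : ∀ N, 0 < α N)
    (h : ∀ x : ℝ, Tendsto (fun N : ℕ => cdf F (α N * x + β N) ^ N) atTop (𝓝 (gevCdf γ x)))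
    {x : ℝ} (hx : 0 < x) :
    Tendsto (fun N : ℕ => (tailQuantile F (N * x) - β N) / α N) atTop
      (𝓝 (gevQuantile γ x)) := by
  have hlarge : ∀ᶠ N : ℕ in atTop, 1 < (N : ℝ) * x :=
    (tendsto_natCast_mul_const_atTop hx).eventually_gt_atTop 1
  rw [tendsto_order]
  constructor
  · intro c hc
    obtain ⟨y, ⟨hy0, hyx⟩, hcy⟩ : ∃ y ∈ Set.Ioo 0 x, c < gevQuantile γ y := by
      have h1 : ∀ᶠ y in 𝓝[<] x, c < gevQuantile γ y :=
        ((continuousAt_gevQuantile γ hx).mono_left nhdsWithin_le_nhds).eventually (lt_mem_nhds hc)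
      have h2 : ∀ᶠ y in 𝓝[<] x, y ∈ Set.Ioo 0 x := Ioo_mem_nhdsLT hx
      obtain ⟨y, hy⟩ := (h2.and h1).exists
      exact ⟨y, hy⟩
    -- The N-th powers of the cdf at the point for y and of the level 1 - 1/(Nx) tend to exp(-1/y)
    -- and exp(-1/x). Their strict order holds eventually, survives taking N-th roots, and becomes a
    -- bound on the quantile.
    have hlim := h (gevQuantile γ y)
    rw [gevCdf_gevQuantile γ hy0] at hlim
    have hev := hlim.eventually_lt (tendsto_one_sub_one_div_mul_pow x) (exp_neg_one_div_lt hy0 hyx)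
    filter_upwards [hev, hlarge] with N hN hNx
    have h1 : cdf F (α N * gevQuantile γ y + β N) < 1 - 1 / (N * x) :=
      lt_of_pow_lt_pow_left₀ N (one_sub_one_div_mem hNx).1.le hN
    rw [← not_le, ← tailQuantile_le_iff F hNx, not_le] at h1
    rw [lt_div_iff₀ (hα N)]
    have := mul_lt_mul_of_pos_left hcy (hα N)
    linarith
  · intro c hc
    obtain ⟨y, hxy, hcy⟩ : ∃ y, x < y ∧ gevQuantile γ y < c := by
      have h1 : ∀ᶠ y in 𝓝[>] x, gevQuantile γ y < c :=
        ((continuousAt_gevQuantile γ hx).mono_left nhdsWithin_le_nhds).eventually (gt_mem_nhds hc)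
      have h2 : ∀ᶠ y in 𝓝[>] x, x < y := self_mem_nhdsWithin
      exact (h2.and h1).exists
    have hlim := h (gevQuantile γ y)
    rw [gevCdf_gevQuantile γ (hx.trans hxy)] at hlim
    have hev := (tendsto_one_sub_one_div_mul_pow x).eventually_lt hlim (exp_neg_one_div_lt hx hxy)
    filter_upwards [hev, hlarge] with N hN hNx
    have h1 : 1 - 1 / (N * x) < cdf F (α N * gevQuantile γ y + β N) :=
      lt_of_pow_lt_pow_left₀ N (cdf_nonneg F _) hN
    have h2 := (tailQuantile_le_iff F hNx).2 h1.le
    rw [div_lt_iff₀ (hα N)]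
    have := mul_lt_mul_of_pos_left hcy (hα N)
    linarith

/-- A version of `tendsto_tailQuantile_sub_div` with moving arguments. -/
lemma tendsto_tailQuantile_sub_div_of_tendsto_div
    (hα : ∀ N, 0 < α N)
    (h : ∀ x : ℝ, 0 < x → Tendsto (fun N : ℕ => (tailQuantile F (N * x) - β N) / α N) atTop
      (𝓝 (gevQuantile γ x)))
    {m : ℕ → ℕ} {t : ℕ → ℝ} (hm : Tendsto m atTop atTop) {x : ℝ} (hx : 0 < x)
    (ht : Tendsto (fun N => t N / m N) atTop (𝓝 x)) :
    Tendsto (fun N => (tailQuantile F (t N) - β (m N)) / α (m N)) atTop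
      (𝓝 (gevQuantile γ x)) := by
  have hmpos : ∀ᶠ N in atTop, (0 : ℝ) < m N := by
    filter_upwards [hm.eventually_gt_atTop 0] with N hN using by exact_mod_cast hN
  rw [tendsto_order]
  constructor
  · intro c hc
    obtain ⟨y, ⟨hy0, hyx⟩, hcy⟩ : ∃ y ∈ Set.Ioo 0 x, c < gevQuantile γ y := by
      have h1 : ∀ᶠ y in 𝓝[<] x, c < gevQuantile γ y :=
        ((continuousAt_gevQuantile γ hx).mono_left nhdsWithin_le_nhds).eventually (lt_mem_nhds hc)
      have h2 : ∀ᶠ y in 𝓝[<] x, y ∈ Set.Ioo 0 x := Ioo_mem_nhdsLT hx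
      obtain ⟨y, hy⟩ := (h2.and h1).exists
      exact ⟨y, hy⟩
    filter_upwards [hmpos, ht.eventually (lt_mem_nhds hyx),
      hm.eventually ((tendsto_natCast_mul_const_atTop hy0).eventually_gt_atTop 1),
      hm.eventually ((h y hy0).eventually (lt_mem_nhds hcy))] with N h0 h1 h2 h3
    refine h3.trans_le ?_
    have : tailQuantile F (m N * y) ≤ tailQuantile F (t N) := by
      refine tailQuantile_mono F h2 ?_
      rw [lt_div_iff₀ h0] at h1
      linarith
    have := (hα (m N)).le
    gcongr
  · intro c hc
    obtain ⟨y, hxy, hcy⟩ : ∃ y, x < y ∧ gevQuantile γ y < c := by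
      have h1 : ∀ᶠ y in 𝓝[>] x, gevQuantile γ y < c :=
        ((continuousAt_gevQuantile γ hx).mono_left nhdsWithin_le_nhds).eventually (gt_mem_nhds hc)
      have h2 : ∀ᶠ y in 𝓝[>] x, x < y := self_mem_nhdsWithin
      exact (h2.and h1).exists
    -- The lower bound t N > m N · x/2 serves only to force 1 < t N, where monotonicity of the tail
    -- quantile is available.
    have hx2 : 0 < x / 2 := by positivity
    filter_upwards [hmpos, ht.eventually (gt_mem_nhds hxy),
      ht.eventually (lt_mem_nhds (half_lt_self hx)),
      hm.eventually ((tendsto_natCast_mul_const_atTop hx2).eventually_gt_atTop 1),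
      hm.eventually ((h y (hx.trans hxy)).eventually (gt_mem_nhds hcy))] with N h0 h1 h2 h3 h4
    refine lt_of_le_of_lt ?_ h4
    have : tailQuantile F (t N) ≤ tailQuantile F (m N * y) := by
      rw [lt_div_iff₀ h0] at h2
      rw [div_lt_iff₀ h0] at h1
      exact tailQuantile_mono F (by linarith) (by linarith)
    have := (hα (m N)).le
    gcongr

end ExtremeValue

/-! ### The three signs of γ: scale, right endpoint, auxiliary function. -/

section ExtremeValueCases

variable {F : Measure ℝ} {γ : ℝ} {α β : ℕ → ℝ}

lemma tendsto_tailQuantile_sub_tailQuantile_div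
    (h : ∀ x : ℝ, 0 < x → Tendsto (fun N : ℕ => (tailQuantile F (N * x) - β N) / α N) atTop
      (𝓝 (gevQuantile γ x))) {x y : ℝ} (hx : 0 < x) (hy : 0 < y) :
    Tendsto (fun N : ℕ => (tailQuantile F (N * x) - tailQuantile F (N * y)) / α N) atTop
      (𝓝 (gevQuantile γ x - gevQuantile γ y)) := by
  refine ((h x hx).sub (h y hy)).congr fun N => ?_
  rw [← sub_div]; ring

lemma gevQuantile_two_pos (γ : ℝ) : 0 < gevQuantile γ 2 := by
  rw [← gevQuantile_one γ]; exact gevQuantile_lt one_pos one_lt_two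

/-- Consecutive doubling increments of the tail quantile thus have limiting ratio 2 ^ γ, the fact
behind both the case γ < 0 and the case γ > 0. -/
lemma gevQuantile_four_sub_two (γ : ℝ) :
    gevQuantile γ 4 - gevQuantile γ 2 = 2 ^ γ * gevQuantile γ 2 := by
  unfold gevQuantile
  have h4 : (4 : ℝ) ^ γ = 2 ^ γ * 2 ^ γ := by
    rw [← Real.mul_rpow (by norm_num) (by norm_num)]; norm_num
  by_cases hγ : γ = 0
  · simp only [hγ, if_true, Real.rpow_zero, one_mul]
    rw [show (4 : ℝ) = 2 * 2 by norm_num, Real.log_mul (by norm_num) (by norm_num)]; ring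
  · simp only [hγ, if_false, h4]; field_simp; ring

/-- A telescoping sum of doubling increments is dominated by a geometric series of ratio ρ. The
induction on k passes from N to 2N, so N stays universally quantified. -/
lemma tailQuantile_two_pow_mul_le {ρ : ℝ} (hρ1 : ρ < 1) {N₀ : ℕ}
    (hstep : ∀ N : ℕ, N₀ ≤ N → tailQuantile F (N * 4) - tailQuantile F (N * 2) ≤
      ρ * (tailQuantile F (N * 2) - tailQuantile F N))
    (hmono : ∀ N : ℕ, N₀ ≤ N → tailQuantile F N ≤ tailQuantile F (N * 2)) (k : ℕ) :
    ∀ N : ℕ, N₀ ≤ N → tailQuantile F (N * 2 ^ k) ≤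
      tailQuantile F N + (tailQuantile F (N * 2) - tailQuantile F N) / (1 - ρ) := by
  have hρ : 0 < 1 - ρ := by linarith
  induction k with
  | zero =>
    intro N hN
    have : 0 ≤ (tailQuantile F (N * 2) - tailQuantile F N) / (1 - ρ) :=
      div_nonneg (by linarith [hmono N hN]) hρ.le
    simpa using this
  | succ k ih =>
    intro N hN
    have h1 := ih (N * 2) (by omega)
    have h2 := hstep N hN
    push_cast at h1
    rw [show (N : ℝ) * 2 * 2 ^ k = N * 2 ^ (k + 1) by ring,
      show (N : ℝ) * 2 * 2 = N * 4 by ring] at h1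
    refine h1.trans ?_
    have h3 : (tailQuantile F (N * 4) - tailQuantile F (N * 2)) / (1 - ρ) ≤
        ρ * (tailQuantile F (N * 2) - tailQuantile F N) / (1 - ρ) := by gcongr
    have h4 : tailQuantile F N + (tailQuantile F (N * 2) - tailQuantile F N) / (1 - ρ) =
        tailQuantile F (N * 2) + ρ * (tailQuantile F (N * 2) - tailQuantile F N) / (1 - ρ) := by
      field_simp; ring
    linarith

lemma tailQuantile_le_toReal_quantile_one (hF : quantile F 1 < ⊤) {t : ℝ} (ht : 1 < t) :
    tailQuantile F t ≤ (quantile F 1).toReal := by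
  have h := quantile_mono F (one_sub_one_div_mem ht).2.le
  rw [← coe_tailQuantile F ht, ← EReal.coe_toReal hF.ne (quantile_one_ne_bot F)] at h
  exact EReal.coe_le_coe_iff.1 h

lemma quantile_one_le_of_forall_tailQuantile_le {b : ℝ}
    (h : ∀ t, 1 < t → tailQuantile F t ≤ b) : quantile F 1 ≤ b := by
  have hb : 1 ≤ cdf F b := by
    have hlim : Tendsto (fun t : ℝ => 1 - 1 / t) atTop (𝓝 (1 - 0)) :=
      tendsto_const_nhds.sub (tendsto_const_nhds.div_atTop tendsto_id)
    rw [sub_zero] at hlim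
    refine le_of_tendsto hlim ?_
    filter_upwards [eventually_gt_atTop 1] with t ht
    exact (tailQuantile_le_iff F ht).1 (h t ht)
  exact iInf₂_le b ⟨hb, one_pos.trans_le hb⟩

/-- Any ρ strictly above the limiting ratio 2 ^ γ eventually dominates the actual ratio, and the
geometric bound holds uniformly along all doublings of N. -/
lemma eventually_quantile_one_le (hα : ∀ N, 0 < α N)
    (h : ∀ x : ℝ, 0 < x → Tendsto (fun N : ℕ => (tailQuantile F (N * x) - β N) / α N) atTop
      (𝓝 (gevQuantile γ x))) {ρ : ℝ} (hρ : 2 ^ γ < ρ) (hρ1 : ρ < 1) :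
    ∀ᶠ N : ℕ in atTop, quantile F 1 ≤
      ((tailQuantile F N + (tailQuantile F (N * 2) - tailQuantile F N) / (1 - ρ) : ℝ) : EReal) := by
  have hD := gevQuantile_two_pos γ
  have h21 := tendsto_tailQuantile_sub_tailQuantile_div h two_pos one_pos
  have h42 := tendsto_tailQuantile_sub_tailQuantile_div h four_pos two_pos
  rw [gevQuantile_one, sub_zero] at h21
  simp only [mul_one] at h21
  rw [gevQuantile_four_sub_two] at h42
  have hev := h42.eventually_lt (h21.const_mul ρ) (mul_lt_mul_of_pos_right hρ hD)
  have hev2 : ∀ᶠ N : ℕ in atTop, tailQuantile F (N * 4) - tailQuantile F (N * 2) ≤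
      ρ * (tailQuantile F (N * 2) - tailQuantile F N) := by
    filter_upwards [hev] with N hN
    rw [← mul_div_assoc, div_lt_div_iff_of_pos_right (hα N)] at hN
    exact hN.le
  obtain ⟨N₁, hN₁⟩ := eventually_atTop.1 hev2
  filter_upwards [eventually_ge_atTop (max N₁ 2)] with N hN
  apply quantile_one_le_of_forall_tailQuantile_le
  intro t ht
  have hN2 : 2 ≤ N := (le_max_right _ _).trans hN
  obtain ⟨k, hk⟩ := pow_unbounded_of_one_lt t one_lt_two
  have hNr : (2 : ℝ) ≤ N := by exact_mod_cast hN2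
  have hk' : t ≤ N * 2 ^ k := by
    have : (0 : ℝ) < 2 ^ k := by positivity
    nlinarith
  refine (tailQuantile_mono F ht hk').trans ?_
  refine tailQuantile_two_pow_mul_le hρ1 (N₀ := max N₁ 2) (fun M hM => hN₁ M ?_) (fun M hM => ?_) k
    N hN
  · exact (le_max_left _ _).trans hM
  · have : (2 : ℝ) ≤ M := by exact_mod_cast (le_max_right _ _).trans hM
    exact tailQuantile_mono F (by linarith) (by linarith)

lemma quantile_one_lt_top_of_neg (hα : ∀ N, 0 < α N)
    (h : ∀ x : ℝ, 0 < x → Tendsto (fun N : ℕ => (tailQuantile F (N * x) - β N) / α N) atTop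
      (𝓝 (gevQuantile γ x))) (hγ : γ < 0) : quantile F 1 < ⊤ := by
  obtain ⟨ρ, h1, h2⟩ := exists_between (Real.rpow_lt_one_of_one_lt_of_neg one_lt_two hγ)
  obtain ⟨N, hN⟩ := (eventually_quantile_one_le hα h h1 h2).exists
  exact hN.trans_lt (EReal.coe_lt_top _)

/-- From below, the endpoint exceeds U(Nx) for every x, and `gevQuantile γ x` → -1/γ as x → ∞. From
above, the geometric bound applies with ρ decreasing to 2 ^ γ, where its limit `gevQuantile γ 2 / (1
- 2 ^ γ)` is again -1/γ. -/
lemma tendsto_quantile_one_sub_tailQuantile_div (hα : ∀ N, 0 < α N)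
    (h : ∀ x : ℝ, 0 < x → Tendsto (fun N : ℕ => (tailQuantile F (N * x) - β N) / α N) atTop
      (𝓝 (gevQuantile γ x))) (hγ : γ < 0) :
    Tendsto (fun N : ℕ => ((quantile F 1).toReal - tailQuantile F N) / α N) atTop
      (𝓝 (-1 / γ)) := by
  have htop := quantile_one_lt_top_of_neg hα h hγ
  rw [tendsto_order]
  constructor
  · intro c hc
    have hlim : Tendsto (gevQuantile γ) atTop (𝓝 (-1 / γ)) := by
      have h1 : Tendsto (fun x : ℝ => x ^ γ) atTop (𝓝 0) := by
        simpa using tendsto_rpow_neg_atTop (y := -γ) (by linarith)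
      have h2 := (h1.sub_const 1).div_const γ
      rw [zero_sub] at h2
      refine h2.congr fun x => ?_
      rw [gevQuantile, if_neg hγ.ne]
    obtain ⟨x, hx1, hx⟩ := ((eventually_gt_atTop 1).and (hlim.eventually (lt_mem_nhds hc))).exists
    have hx0 : 0 < x := one_pos.trans hx1
    have h1 := tendsto_tailQuantile_sub_tailQuantile_div h hx0 one_pos
    rw [gevQuantile_one, sub_zero] at h1
    filter_upwards [h1.eventually (lt_mem_nhds hx),
      (tendsto_natCast_mul_const_atTop hx0).eventually_gt_atTop 1] with N hN hNx
    refine hN.trans_le ?_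
    rw [mul_one]
    have := (hα N).le
    have := tailQuantile_le_toReal_quantile_one htop hNx
    gcongr
  · intro c hc
    have h2γ := Real.rpow_lt_one_of_one_lt_of_neg one_lt_two hγ
    have hval : gevQuantile γ 2 / (1 - 2 ^ γ) = -1 / γ := by
      have : (1 - (2 : ℝ) ^ γ) ≠ 0 := by linarith
      rw [gevQuantile, if_neg hγ.ne]
      have := hγ.ne
      field_simp; ring
    obtain ⟨ρ, ⟨hρ, hρ1⟩, hρc⟩ : ∃ ρ ∈ Set.Ioo ((2 : ℝ) ^ γ) 1,
        gevQuantile γ 2 / (1 - ρ) < c := by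
      have hcont : Tendsto (fun ρ : ℝ => gevQuantile γ 2 / (1 - ρ)) (𝓝[>] ((2 : ℝ) ^ γ))
          (𝓝 (gevQuantile γ 2 / (1 - 2 ^ γ))) := by
        apply Tendsto.mono_left _ nhdsWithin_le_nhds
        exact tendsto_const_nhds.div (tendsto_const_nhds.sub tendsto_id) (by linarith)
      rw [hval] at hcont
      have h2 : ∀ᶠ y in 𝓝[>] ((2 : ℝ) ^ γ), y ∈ Set.Ioo ((2 : ℝ) ^ γ) 1 := Ioo_mem_nhdsGT h2γ
      obtain ⟨ρ, hρ⟩ := (h2.and (hcont.eventually (gt_mem_nhds hc))).exists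
      exact ⟨ρ, hρ⟩
    have h1 := (tendsto_tailQuantile_sub_tailQuantile_div h two_pos one_pos).div_const (1 - ρ)
    rw [gevQuantile_one, sub_zero] at h1
    filter_upwards [eventually_quantile_one_le hα h hρ hρ1, h1.eventually (gt_mem_nhds hρc)]
      with N hN hN2
    refine lt_of_le_of_lt ?_ hN2
    rw [← EReal.coe_toReal htop.ne (quantile_one_ne_bot F), EReal.coe_le_coe_iff] at hN
    rw [div_right_comm]
    have := (hα N).le
    rw [mul_one]
    gcongr
    linarith

/-- The recursion is an asymptotic affine contraction with fixed point d₀/(1 - c₀). The distance to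
that point shrinks by a factor ρ < 1, up to a vanishing error, each time N is halved. -/
lemma tendsto_of_halving_recursion {R c d : ℕ → ℝ} {c₀ d₀ : ℝ} (hc₀ : |c₀| < 1)
    (hc : Tendsto c atTop (𝓝 c₀)) (hd : Tendsto d atTop (𝓝 d₀))
    (hR : ∀ᶠ N in atTop, R N = c N * R (N / 2) + d N) :
    Tendsto R atTop (𝓝 (d₀ / (1 - c₀))) := by
  obtain ⟨ρ, hρ0, hρ1⟩ := exists_between hc₀
  have hρpos : 0 < ρ := (abs_nonneg _).trans_lt hρ0
  set r := d₀ / (1 - c₀) with hr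
  have hfix : r = c₀ * r + d₀ := by
    have : 1 - c₀ ≠ 0 := by linarith [le_abs_self c₀]
    rw [hr]; field_simp; ring
  have herr : Tendsto (fun N => c N * r + d N - r) atTop (𝓝 0) := by
    have := ((hc.mul_const r).add hd).sub_const r
    rwa [← hfix, sub_self] at this
  rw [Metric.tendsto_atTop]
  intro ε hε
  have hε2 : 0 < ε / 2 := by positivity
  -- Once the error is below (1 - ρ)ε/2, subtracting ε/2 turns the perturbed contraction into a
  -- homogeneous one that can be iterated.
  have hev : ∀ᶠ N in atTop, |R N - r| - ε / 2 ≤ ρ * (|R (N / 2) - r| - ε / 2) := by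
    have h1 : ∀ᶠ N in atTop, |c N| < ρ := hc.abs.eventually (gt_mem_nhds hρ0)
    have h2 : ∀ᶠ N in atTop, |c N * r + d N - r| < (1 - ρ) * (ε / 2) := by
      have := herr.abs
      rw [abs_zero] at this
      exact this.eventually (gt_mem_nhds (mul_pos (by linarith) hε2))
    filter_upwards [hR, h1, h2] with N hN h1 h2
    have h3 : R N - r = c N * (R (N / 2) - r) + (c N * r + d N - r) := by rw [hN]; ring
    have h4 : |R N - r| ≤ |c N| * |R (N / 2) - r| + |c N * r + d N - r| := by
      rw [h3, ← abs_mul]; exact abs_add_le _ _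
    have h5 : |c N| * |R (N / 2) - r| ≤ ρ * |R (N / 2) - r| := by gcongr
    linarith
  obtain ⟨N₀, hN₀⟩ := eventually_atTop.1 (hev.and (eventually_gt_atTop 0))
  obtain ⟨C, hC0, hC⟩ : ∃ C, 0 ≤ C ∧ ∀ N ≤ N₀, |R N - r| - ε / 2 ≤ C := by
    refine ⟨∑ N ∈ Finset.range (N₀ + 1), |R N - r|, Finset.sum_nonneg fun _ _ => abs_nonneg _,
      fun N hN => ?_⟩
    have := Finset.single_le_sum (f := fun N => |R N - r|) (fun _ _ => abs_nonneg _)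
      (Finset.mem_range.2 (Nat.lt_succ_of_le hN))
    linarith
  have hbound : ∀ N, |R N - r| - ε / 2 ≤ C := by
    intro N
    induction N using Nat.strong_induction_on with
    | _ N ih =>
      by_cases hN : N ≤ N₀
      · exact hC N hN
      · obtain ⟨h1, h2⟩ := hN₀ N (by omega)
        have h3 := ih (N / 2) (Nat.div_lt_self h2 one_lt_two)
        calc _ ≤ ρ * (|R (N / 2) - r| - ε / 2) := h1
          _ ≤ ρ * C := by gcongr
          _ ≤ 1 * C := by gcongr
          _ = C := one_mul C
  -- The size condition keeps N beyond N₀ through k halvings, despite rounding down.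
  have hpow : ∀ k N, 2 ^ k * (N₀ + 1) ≤ N → |R N - r| - ε / 2 ≤ ρ ^ k * C := by
    intro k
    induction k with
    | zero => intro N _; simpa using hbound N
    | succ k ih =>
      intro N hN
      have h0 : 1 ≤ 2 ^ k := Nat.one_le_two_pow
      have hN' : N₀ ≤ N := by rw [pow_succ] at hN; nlinarith
      refine (hN₀ N hN').1.trans ?_
      rw [pow_succ', mul_assoc]
      have := ih (N / 2) (by rw [Nat.le_div_iff_mul_le two_pos]; rw [pow_succ] at hN; nlinarith)
      gcongr
  obtain ⟨k, hk⟩ : ∃ k : ℕ, ρ ^ k * C < ε / 2 := by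
    have := (tendsto_pow_atTop_nhds_zero_of_lt_one hρpos.le hρ1).mul_const C
    rw [zero_mul] at this
    exact (this.eventually (gt_mem_nhds hε2)).exists
  refine ⟨2 ^ k * (N₀ + 1), fun N hN => ?_⟩
  rw [Real.dist_eq]
  have := hpow k N hN
  linarith

lemma tendsto_div_two_atTop : Tendsto (fun N : ℕ => N / 2) atTop atTop :=
  Nat.tendsto_div_const_atTop two_ne_zero

lemma tendsto_cast_div_cast_div_two :
    Tendsto (fun N : ℕ => (N : ℝ) / (N / 2 : ℕ)) atTop (𝓝 2) := by
  have h1 : Tendsto (fun N : ℕ => 2 + 1 / ((N / 2 : ℕ) : ℝ)) atTop (𝓝 (2 + 0)) :=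
    tendsto_const_nhds.add (tendsto_const_nhds.div_atTop
      (tendsto_natCast_atTop_atTop.comp tendsto_div_two_atTop))
  rw [add_zero] at h1
  refine tendsto_of_tendsto_of_tendsto_of_le_of_le' tendsto_const_nhds h1 ?_ ?_
  · filter_upwards [eventually_ge_atTop 2] with N hN
    have h2 : 0 < N / 2 := by omega
    have h3 : 2 * (N / 2) ≤ N := by omega
    rw [le_div_iff₀ (by exact_mod_cast h2)]
    exact_mod_cast h3
  · filter_upwards [eventually_ge_atTop 2] with N hN
    have h2 : 0 < N / 2 := by omega
    have h3 : N ≤ 2 * (N / 2) + 1 := by omega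
    have h2' : (0 : ℝ) < (N / 2 : ℕ) := by exact_mod_cast h2
    rw [div_le_iff₀ h2', add_mul, one_div, inv_mul_cancel₀ h2'.ne']
    exact_mod_cast h3

/-- U(N)/α_N obeys a halving recursion with coefficient α_{N/2}/α_N. Measuring the increment U(2N) -
U(N) in both scales shows that this coefficient tends to 2 ^ (-γ), a contraction because γ > 0. The
fixed point is 1/γ. -/
lemma tendsto_tailQuantile_div (hα : ∀ N, 0 < α N)
    (h : ∀ x : ℝ, 0 < x → Tendsto (fun N : ℕ => (tailQuantile F (N * x) - β N) / α N) atTop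
      (𝓝 (gevQuantile γ x))) (hγ : 0 < γ) :
    Tendsto (fun N : ℕ => tailQuantile F N / α N) atTop (𝓝 (1 / γ)) := by
  have hD := gevQuantile_two_pos γ
  have h2γ : 1 < (2 : ℝ) ^ γ := Real.one_lt_rpow one_lt_two hγ
  have hm := tendsto_div_two_atTop
  have hN := tendsto_cast_div_cast_div_two
  have hN2 : Tendsto (fun N : ℕ => (N : ℝ) * 2 / (N / 2 : ℕ)) atTop (𝓝 4) := by
    have := hN.mul_const 2
    rw [show (2 : ℝ) * 2 = 4 by norm_num] at this
    exact this.congr fun N => by ring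
  have k1 := tendsto_tailQuantile_sub_div_of_tendsto_div hα h hm two_pos hN
  have k2 := tendsto_tailQuantile_sub_div_of_tendsto_div hα h hm four_pos hN2
  have k3 := (h 1 one_pos).comp hm
  have k4 := tendsto_tailQuantile_sub_tailQuantile_div h two_pos one_pos
  rw [gevQuantile_one, sub_zero] at k4
  have hratio : Tendsto (fun N : ℕ => α (N / 2) / α N) atTop (𝓝 ((2 ^ γ)⁻¹)) := by
    have k5 := k2.sub k1
    rw [gevQuantile_four_sub_two] at k5
    have k6 := k4.div k5 (by positivity)
    have hval : gevQuantile γ 2 / (2 ^ γ * gevQuantile γ 2) = (2 ^ γ)⁻¹ := by field_simp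
    rw [hval] at k6
    refine k6.congr' ?_
    filter_upwards [k4.eventually (lt_mem_nhds hD)] with N hN
    have e1 := hα N
    have e2 := hα (N / 2)
    have e3 : 0 < tailQuantile F (N * 2) - tailQuantile F (N * 1) := by
      by_contra! hneg
      exact absurd hN (not_lt.2 (div_nonpos_of_nonpos_of_nonneg hneg e1.le))
    rw [mul_one] at e3
    simp only [Pi.div_apply, mul_one]
    rw [← sub_div, sub_sub_sub_cancel_right]
    field_simp
  have hincr : Tendsto (fun N : ℕ => (tailQuantile F N - tailQuantile F (N / 2 : ℕ)) / α N) atTop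
      (𝓝 (gevQuantile γ 2 * (2 ^ γ)⁻¹)) := by
    have k5 := (k1.sub k3).mul hratio
    rw [gevQuantile_one, sub_zero] at k5
    refine k5.congr fun N => ?_
    have e1 := hα N
    have e2 := hα (N / 2)
    simp only [Function.comp_apply, mul_one]
    field_simp
    ring
  have hc : |((2 : ℝ) ^ γ)⁻¹| < 1 := by
    rw [abs_of_pos (by positivity)]; exact inv_lt_one_of_one_lt₀ h2γ
  have hmain := tendsto_of_halving_recursion (R := fun N => tailQuantile F N / α N) hc hratio hincr
    (Eventually.of_forall fun N => by
      have e1 := hα N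
      have e2 := hα (N / 2)
      field_simp
      ring)
  convert! hmain using 2
  have : (2 : ℝ) ^ γ - 1 ≠ 0 := by linarith
  rw [gevQuantile, if_neg hγ.ne']
  field_simp

/-- The scale must depend on t = U(N) rather than on N. Since N(1 - F(U(N))) → 1, the index is
recovered as N ≈ 1/(1 - F(t)), and U(e/(1 - F(t))) - t is then asymptotic to α_N log e = α_N. The
fallback value 1 only secures positivity everywhere. -/
lemma exists_isAuxiliaryFunction (hα : ∀ N, 0 < α N)
    (h : ∀ x : ℝ, 0 < x → Tendsto (fun N : ℕ => (tailQuantile F (N * x) - β N) / α N) atTop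
      (𝓝 (gevQuantile 0 x))) : ∃ f : ℝ → ℝ, IsAuxiliaryFunction F f := by
  have hdiff : ∀ x : ℝ, 0 < x → Tendsto
      (fun N : ℕ => (tailQuantile F (N * x) - tailQuantile F N) / α N) atTop
      (𝓝 (Real.log x)) := by
    intro x hx
    have := tendsto_tailQuantile_sub_tailQuantile_div h hx one_pos
    rw [gevQuantile_one, sub_zero, gevQuantile, if_pos rfl] at this
    simpa using this
  let g : ℝ → ℝ := fun t => tailQuantile F (Real.exp 1 / (1 - cdf F t)) - t
  refine ⟨fun t => if 0 < g t then g t else 1, fun t => ?_, fun x hx => ?_⟩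
  · simp only
    split_ifs with ht
    exacts [ht, one_pos]
  have hN1 : ∀ᶠ N : ℕ in atTop, (1 : ℝ) < N := by
    filter_upwards [eventually_gt_atTop 1] with N hN using by exact_mod_cast hN
  have hle : ∀ᶠ N : ℕ in atTop, (N : ℝ) * (1 - cdf F (tailQuantile F N)) ≤ 1 := by
    filter_upwards [hN1] with N hN
    have h1 := (tailQuantile_le_iff F hN).1 le_rfl
    have h0 : (0 : ℝ) < N := by linarith
    have : 1 - cdf F (tailQuantile F N) ≤ 1 / N := by linarith
    rwa [le_div_iff₀ h0, mul_comm] at this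
  -- If y > 1 then U(N) < U(Ny) eventually, because the normalized increment tends to log y > 0.
  -- Hence U(N) has not reached the level 1 - 1/(Ny).
  have hgt : ∀ y : ℝ, 1 < y → ∀ᶠ N : ℕ in atTop,
      1 / y < (N : ℝ) * (1 - cdf F (tailQuantile F N)) := by
    intro y hy
    have hy0 : 0 < y := by linarith
    filter_upwards [hN1, (hdiff y hy0).eventually (lt_mem_nhds (Real.log_pos hy)),
      (tendsto_natCast_mul_const_atTop hy0).eventually_gt_atTop 1] with N hN h1 h2
    have h3 : tailQuantile F N < tailQuantile F (N * y) := by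
      by_contra! hneg
      exact absurd h1 (not_lt.2 (div_nonpos_of_nonpos_of_nonneg (by linarith) (hα N).le))
    rw [← not_le, tailQuantile_le_iff F h2, not_le] at h3
    have h0 : (0 : ℝ) < N := by linarith
    have : 1 / (N * y) < 1 - cdf F (tailQuantile F N) := by linarith
    calc 1 / y = N * (1 / (N * y)) := by field_simp
      _ < _ := by gcongr
  have hone : Tendsto (fun N : ℕ => (N : ℝ) * (1 - cdf F (tailQuantile F N))) atTop (𝓝 1) := by
    rw [tendsto_order]
    refine ⟨fun c hc => ?_, fun c hc => ?_⟩
    · have hm : max c (1 / 2) < 1 := max_lt hc (by norm_num)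
      have h0 : 0 < max c (1 / 2) := lt_max_of_lt_right (by norm_num)
      filter_upwards [hgt (1 / max c (1 / 2)) (by rw [lt_div_iff₀ h0]; linarith)] with N hN
      rw [one_div_one_div] at hN
      exact (le_max_left _ _).trans_lt hN
    · filter_upwards [hle] with N hN using hN.trans_lt hc
  have hs : Tendsto (fun N : ℕ => Real.exp 1 / (1 - cdf F (tailQuantile F N)) / (id N : ℕ)) atTop
      (𝓝 (Real.exp 1)) := by
    have := (tendsto_const_nhds (x := Real.exp 1)).div hone one_ne_zero
    rw [div_one] at this
    exact this.congr fun N => by simp [div_div, mul_comm]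
  have hg : Tendsto (fun N : ℕ => g (tailQuantile F N) / α N) atTop (𝓝 1) := by
    have k1 := tendsto_tailQuantile_sub_div_of_tendsto_div hα h tendsto_id (Real.exp_pos 1) hs
    have k2 := k1.sub (h 1 one_pos)
    rw [gevQuantile_one, sub_zero, gevQuantile, if_pos rfl, Real.log_exp] at k2
    refine k2.congr fun N => ?_
    simp only [id, mul_one, g]
    rw [← sub_div]; ring
  have hfin := (hdiff x hx).div hg one_ne_zero
  rw [div_one] at hfin
  refine hfin.congr' ?_
  filter_upwards [hg.eventually (lt_mem_nhds one_pos)] with N hN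
  have hpos : 0 < g (tailQuantile F N) := by
    by_contra! hneg
    exact absurd hN (not_lt.2 (div_nonpos_of_nonpos_of_nonneg hneg (hα N).le))
  change _ = (tailQuantile F (N * x) - tailQuantile F N) /
    (if 0 < g (tailQuantile F N) then g (tailQuantile F N) else 1)
  rw [if_pos hpos]
  have := hα N
  simp only [Pi.div_apply]
  field_simp

end ExtremeValueCases

/-! ### Top order statistics and the smallest coordinates of an iid sample. -/

section OrderStatistics

lemma antitone_comp_sort_rev {N : ℕ} (x : Fin N → ℝ) :
    Antitone fun j : Fin N => x (Tuple.sort x (Fin.rev j)) :=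
  fun _ _ h => Tuple.monotone_sort x (Fin.rev_le_rev.2 h)

lemma card_filter_comp_sort_rev {N : ℕ} (x : Fin N → ℝ) (p : ℝ → Prop) [DecidablePred p] :
    (Finset.univ.filter fun j : Fin N => p (x (Tuple.sort x (Fin.rev j)))).card =
      (Finset.univ.filter fun j : Fin N => p (x j)).card := by
  rw [Finset.card_filter, Finset.card_filter]
  exact Equiv.sum_comp (Fin.revPerm.trans (Tuple.sort x)) fun j => if p (x j) then 1 else 0

/-- Counting coordinates above a level is invariant under sorting, so order statistics can be
handled, and shown measurable, without the sorting permutation. -/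
lemma le_topOrderStat_iff {N k : ℕ} (hk : k < N) (x : Fin N → ℝ) (c : ℝ) :
    c ≤ topOrderStat N x k ↔ k < (Finset.univ.filter fun j : Fin N => c ≤ x j).card := by
  rw [topOrderStat, dif_pos hk, ← card_filter_comp_sort_rev x (fun y => c ≤ y)]
  exact (Tuple.lt_card_ge_iff_apply_ge_of_antitone (j := ⟨k, hk⟩) (antitone_comp_sort_rev x)).symm

lemma lt_topOrderStat_iff {N k : ℕ} (hk : k < N) (x : Fin N → ℝ) (c : ℝ) :
    c < topOrderStat N x k ↔ k < (Finset.univ.filter fun j : Fin N => c < x j).card := by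
  rw [topOrderStat, dif_pos hk, ← card_filter_comp_sort_rev x (fun y => c < y)]
  exact (Tuple.lt_card_gt_iff_apply_gt_of_antitone (j := ⟨k, hk⟩) (antitone_comp_sort_rev x)).symm

lemma measurable_topOrderStat (N k : ℕ) : Measurable fun x : Fin N → ℝ => topOrderStat N x k := by
  by_cases hk : k < N
  · refine measurable_of_Ioi fun c => ?_
    have : (fun x : Fin N → ℝ => topOrderStat N x k) ⁻¹' Set.Ioi c =
        {x | k < ∑ j, if c < x j then 1 else 0} := by
      ext x
      simp only [Set.mem_preimage, Set.mem_Ioi, Set.mem_ofPred_eq, ← Finset.card_filter]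
      exact lt_topOrderStat_iff hk x c
    rw [this]
    refine measurableSet_lt measurable_const (Finset.measurable_sum _ fun j _ => ?_)
    exact Measurable.ite (measurableSet_lt measurable_const (measurable_pi_apply j))
      measurable_const measurable_const
  · simp only [topOrderStat, dif_neg hk]
    exact measurable_const

lemma topOrderStat_eq_of_embedding {N m : ℕ} (x : Fin N → ℝ) (e : Fin m ↪ Fin N)
    (he : Antitone fun i => x (e i)) (hx : ∀ j ∉ Set.range e, ∀ i, x j ≤ x (e i)) (k : Fin m) :
    topOrderStat N x k = x (e k) := by
  have hmN : m ≤ N := by simpa using Fintype.card_le_of_embedding e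
  have hk : (k : ℕ) < N := k.2.trans_le hmN
  apply le_antisymm
  · rw [← not_lt, lt_topOrderStat_iff hk, not_lt]
    calc _ ≤ ((Finset.Iio k).map e).card := Finset.card_le_card fun j hj => by
          rw [Finset.mem_filter] at hj
          obtain ⟨i, rfl⟩ : j ∈ Set.range e := by
            by_contra hj'
            exact absurd hj.2 (not_lt.2 (hx j hj' k))
          refine Finset.mem_map_of_mem e (Finset.mem_Iio.2 ?_)
          by_contra! hki
          exact absurd hj.2 (not_lt.2 (he hki))
      _ = k := by simp
  · rw [le_topOrderStat_iff hk]
    calc (k : ℕ) < ((Finset.Iic k).map e).card := by simp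
      _ ≤ _ := Finset.card_le_card fun j hj => by
        rw [Finset.mem_map] at hj
        obtain ⟨i, hi, rfl⟩ := hj
        exact Finset.mem_filter.2 ⟨Finset.mem_univ _, he (Finset.mem_Iic.1 hi)⟩

lemma topOrderStat_le_iff_forall {N : ℕ} (hN : 0 < N) (x : Fin N → ℝ) (c : ℝ) :
    topOrderStat N x 0 ≤ c ↔ ∀ i, x i ≤ c := by
  rw [← not_lt, lt_topOrderStat_iff hN, Finset.card_pos, Finset.not_nonempty_iff_eq_empty,
    Finset.filter_eq_empty_iff]
  simp

/-- The event that `e` lists the indices of the smallest coordinates, in increasing order. -/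
def bottomEvent {N q : ℕ} (e : Fin (q + 1) ↪ Fin N) : Set (Fin N → ℝ) :=
  {v | StrictMono (fun i => v (e i)) ∧ ∀ j ∉ Set.range e, v (e (Fin.last q)) < v j}

lemma measurableSet_strictMono (m : ℕ) : MeasurableSet {w : Fin m → ℝ | StrictMono w} := by
  have : {w : Fin m → ℝ | StrictMono w} = ⋂ i, ⋂ j, ⋂ (_ : i < j), {w | w i < w j} := by
    ext w; simp [StrictMono]
  rw [this]
  exact MeasurableSet.iInter fun i => MeasurableSet.iInter fun j => MeasurableSet.iInter fun _ =>
    measurableSet_lt (measurable_pi_apply i) (measurable_pi_apply j)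

lemma measurableSet_bottomEvent {N q : ℕ} (e : Fin (q + 1) ↪ Fin N) :
    MeasurableSet (bottomEvent e) := by
  have hm : Measurable fun (v : Fin N → ℝ) (i : Fin (q + 1)) => v (e i) :=
    measurable_pi_lambda _ fun i => measurable_pi_apply (e i)
  have h1 : MeasurableSet {v : Fin N → ℝ | StrictMono fun i => v (e i)} :=
    hm (measurableSet_strictMono (q + 1))
  refine h1.inter ?_
  have : {v : Fin N → ℝ | ∀ j ∉ Set.range e, v (e (Fin.last q)) < v j} =
      ⋂ j, ⋂ (_ : j ∉ Set.range e), {v | v (e (Fin.last q)) < v j} := by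
    ext v; simp
  change MeasurableSet {v : Fin N → ℝ | ∀ j ∉ Set.range e, v (e (Fin.last q)) < v j}
  rw [this]
  exact MeasurableSet.iInter fun j => MeasurableSet.iInter fun _ =>
    measurableSet_lt (measurable_pi_apply _) (measurable_pi_apply j)

/-- A decreasing transformation carries the smallest coordinates to the largest values. Ties created
by a flat piece of φ are harmless, since only values and not indices are compared. -/
lemma topOrderStat_of_mem_bottomEvent {N q : ℕ} {e : Fin (q + 1) ↪ Fin N} {v : Fin N → ℝ}
    (hv : v ∈ bottomEvent e) {φ : ℝ → ℝ} {s : Set ℝ} (hφ : AntitoneOn φ s) (hs : ∀ i, v i ∈ s)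
    (k : Fin (q + 1)) : topOrderStat N (fun i => φ (v i)) k = φ (v (e k)) := by
  refine topOrderStat_eq_of_embedding _ e (fun i j hij => ?_) (fun j hj i => ?_) k
  · exact hφ (hs _) (hs _) (hv.1.monotone hij)
  · exact hφ (hs _) (hs _) ((hv.1.monotone (Fin.le_last i)).trans (hv.2 j hj).le)

lemma existsUnique_bottomEvent {N q : ℕ} (hq : q < N) {v : Fin N → ℝ}
    (hv : Function.Injective v) : ∃! e : Fin (q + 1) ↪ Fin N, v ∈ bottomEvent e := by
  have hmono : StrictMono (v ∘ Tuple.sort v) :=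
    (Tuple.monotone_sort v).strictMono_of_injective (hv.comp (Tuple.sort v).injective)
  have h2 : v ∈ bottomEvent ((Fin.castLEEmb hq).trans (Tuple.sort v).toEmbedding) := by
    refine ⟨fun i j hij => hmono hij, fun j hj => ?_⟩
    obtain ⟨i, rfl⟩ := (Tuple.sort v).surjective j
    refine hmono ?_
    by_contra! hle
    refine hj ⟨⟨i, ?_⟩, ?_⟩
    · have : (i : ℕ) ≤ q := by simpa [Fin.le_def] using hle
      omega
    · simp
  refine ⟨_, h2, fun e he => ?_⟩
  ext k : 1
  -- Uniqueness: for any admissible e the numbers -v (e k) are the top order statistics of -v, so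
  -- injectivity of v determines e.
  refine hv (neg_injective ?_)
  have hneg : AntitoneOn (fun y : ℝ => -y) Set.univ := fun _ _ _ _ h => neg_le_neg h
  rw [← topOrderStat_of_mem_bottomEvent he hneg (fun _ => Set.mem_univ _) k,
    ← topOrderStat_of_mem_bottomEvent h2 hneg (fun _ => Set.mem_univ _) k]

lemma ae_injective_pi {ι : Type*} [Fintype ι] (μ : Measure ℝ) [IsProbabilityMeasure μ]
    [NullSingletonClass μ] : ∀ᵐ v ∂(Measure.pi fun _ : ι => μ), Function.Injective v := by
  have h : ∀ i j : ι, ∀ᵐ v ∂(Measure.pi fun _ : ι => μ), v i = v j → i = j := by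
    intro i j
    by_cases hij : i = j
    · exact Eventually.of_forall fun _ _ => hij
    have hind : iIndepFun (fun (i : ι) (v : ι → ℝ) => v i) (Measure.pi fun _ : ι => μ) :=
      iIndepFun_pi (X := fun _ : ι => (id : ℝ → ℝ)) fun _ => aemeasurable_id
    have h2 := (indepFun_iff_map_prod_eq_prod_map_map (measurable_pi_apply i).aemeasurable
      (measurable_pi_apply j).aemeasurable).1 (hind.indepFun hij)
    rw [(measurePreserving_eval (fun _ : ι => μ) i).map_eq,
      (measurePreserving_eval (fun _ : ι => μ) j).map_eq] at h2
    have hdiag : MeasurableSet {p : ℝ × ℝ | p.1 = p.2} := measurableSet_eq_fun measurable_fst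
      measurable_snd
    have h3 : (μ.prod μ) {p : ℝ × ℝ | p.1 = p.2} = 0 := by
      rw [Measure.prod_apply hdiag]
      simp
    rw [← h2, Measure.map_apply (by fun_prop) hdiag] at h3
    filter_upwards [measure_eq_zero_iff_ae_notMem.1 h3] with v hv heq
    exact absurd heq hv
  filter_upwards [ae_all_iff.2 fun i => ae_all_iff.2 (h i)] with v hv i j hij using hv i j hij

/-- By Tonelli, integrate out the N - (q + 1) coordinates not listed by e. Given the listed ones,
each must independently exceed the largest of them, which produces the power of the tail mass. -/
lemma setLIntegral_bottomEvent {N q : ℕ} (e : Fin (q + 1) ↪ Fin N)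
    (μ : Measure ℝ) [IsProbabilityMeasure μ] {ψ : (Fin (q + 1) → ℝ) → ℝ≥0∞} (hψ : Measurable ψ) :
    ∫⁻ v in bottomEvent e, ψ (fun i => v (e i)) ∂(Measure.pi fun _ : Fin N => μ) =
      ∫⁻ w in {w | StrictMono w}, ψ w * μ (Set.Ioi (w (Fin.last q))) ^ (N - (q + 1))
        ∂(Measure.pi fun _ : Fin (q + 1) => μ) := by
  classical
  obtain ⟨p, hp⟩ : ∃ p : Fin N → Prop, ∀ j, j ∈ Set.range e ↔ p j := ⟨_, fun _ => Iff.rfl⟩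
  let E : Fin (q + 1) ≃ {j // p j} :=
    (Equiv.ofInjective e e.injective).trans (Equiv.subtypeEquivRight hp)
  have hmp := measurePreserving_piEquivPiSubtypeProd (fun _ : Fin N => μ) p
  have hmpE := measurePreserving_piCongrLeft (fun _ : {j // p j} => μ) E
  have hcard : Fintype.card {j // ¬ p j} = N - (q + 1) := by
    have h1 : Fintype.card {j // p j} = q + 1 := by rw [← Fintype.card_congr E, Fintype.card_fin]
    rw [Fintype.card_subtype_compl, h1, Fintype.card_fin]
  let g : ({j // p j} → ℝ) × ({j // ¬ p j} → ℝ) → ℝ≥0∞ :=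
    {ab | StrictMono (fun i => ab.1 (E i)) ∧ ∀ j, ab.1 (E (Fin.last q)) < ab.2 j}.indicator
      fun ab => ψ fun i => ab.1 (E i)
  have hE : Measurable fun ab : ({j // p j} → ℝ) × ({j // ¬ p j} → ℝ) => fun i => ab.1 (E i) :=
    measurable_pi_lambda _ fun i => (measurable_pi_apply (E i)).comp measurable_fst
  have hset : MeasurableSet {ab : ({j // p j} → ℝ) × ({j // ¬ p j} → ℝ) |
      StrictMono (fun i => ab.1 (E i)) ∧ ∀ j, ab.1 (E (Fin.last q)) < ab.2 j} := by
    refine (hE (measurableSet_strictMono (q + 1))).inter ?_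
    have : {ab : ({j // p j} → ℝ) × ({j // ¬ p j} → ℝ) | ∀ j, ab.1 (E (Fin.last q)) < ab.2 j} =
        ⋂ j, {ab | ab.1 (E (Fin.last q)) < ab.2 j} := by ext; simp
    change MeasurableSet {ab : ({j // p j} → ℝ) × ({j // ¬ p j} → ℝ) |
      ∀ j, ab.1 (E (Fin.last q)) < ab.2 j}
    rw [this]
    exact MeasurableSet.iInter fun j => measurableSet_lt
      ((measurable_pi_apply _).comp measurable_fst) ((measurable_pi_apply j).comp measurable_snd)
  have hg : Measurable g := (hψ.comp hE).indicator hset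
  have h1 : ∫⁻ v in bottomEvent e, ψ (fun i => v (e i)) ∂(Measure.pi fun _ : Fin N => μ) =
      ∫⁻ v, g (MeasurableEquiv.piEquivPiSubtypeProd (fun _ : Fin N => ℝ) p v)
        ∂(Measure.pi fun _ : Fin N => μ) := by
    rw [← lintegral_indicator (measurableSet_bottomEvent e)]
    refine lintegral_congr fun v => ?_
    have hiff : (MeasurableEquiv.piEquivPiSubtypeProd (fun _ : Fin N => ℝ) p v) ∈
        {ab : ({j // p j} → ℝ) × ({j // ¬ p j} → ℝ) |
          StrictMono (fun i => ab.1 (E i)) ∧ ∀ j, ab.1 (E (Fin.last q)) < ab.2 j} ↔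
        v ∈ bottomEvent e := by
      simp only [Set.mem_ofPred_eq, bottomEvent]
      exact and_congr Iff.rfl ⟨fun h j hj => h ⟨j, mt (hp j).2 hj⟩,
        fun h j => h j.1 (mt (hp j).1 j.2)⟩
    by_cases hv : v ∈ bottomEvent e
    · rw [Set.indicator_of_mem hv]
      exact (Set.indicator_of_mem (hiff.2 hv) fun ab => ψ fun i => ab.1 (E i)).symm
    · rw [Set.indicator_of_notMem hv]
      exact (Set.indicator_of_notMem (mt hiff.1 hv) fun ab => ψ fun i => ab.1 (E i)).symm
  rw [h1, hmp.lintegral_comp hg, lintegral_prod _ hg.aemeasurable, ← hmpE.lintegral_comp_emb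
    (MeasurableEquiv.measurableEmbedding _), ← lintegral_indicator (measurableSet_strictMono _)]
  refine lintegral_congr fun w => ?_
  have hw : ∀ i, MeasurableEquiv.piCongrLeft (fun _ : {j // p j} => ℝ) E w (E i) = w i :=
    fun i => Equiv.piCongrLeft_apply_apply (P := fun _ : {j // p j} => ℝ) E w i
  by_cases hmono : StrictMono w
  · rw [Set.indicator_of_mem (show w ∈ {w | StrictMono w} from hmono)]
    have h2 : ∀ b : {j // ¬ p j} → ℝ,
        g (MeasurableEquiv.piCongrLeft (fun _ : {j // p j} => ℝ) E w, b) =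
        (Set.univ.pi fun _ => Set.Ioi (w (Fin.last q))).indicator (fun _ => ψ w) b := by
      intro b
      simp only [g, Set.indicator_apply, Set.mem_ofPred_eq, hw, Set.mem_pi, Set.mem_univ,
        forall_true_left, Set.mem_Ioi]
      simp [hmono]
    simp only [h2]
    rw [lintegral_indicator (MeasurableSet.univ_pi fun _ => measurableSet_Ioi), setLIntegral_const,
      Measure.pi_pi, Finset.prod_const, Finset.card_univ, hcard]
  · rw [Set.indicator_of_notMem (show w ∉ {w | StrictMono w} from hmono)]
    have h2 : ∀ b : {j // ¬ p j} → ℝ,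
        g (MeasurableEquiv.piCongrLeft (fun _ : {j // p j} => ℝ) E w, b) = 0 := by
      intro b
      refine Set.indicator_of_notMem ?_ _
      simp only [Set.mem_ofPred_eq, hw]
      exact fun h => hmono h.1
    simp [h2]

/-- The integral of a function of the `q + 1` smallest coordinates of an iid sample. -/
lemma lintegral_bottom_coordinates {N q : ℕ} (hq : q < N)
    (μ : Measure ℝ) [IsProbabilityMeasure μ] [NullSingletonClass μ] {ψ : (Fin (q + 1) → ℝ) → ℝ≥0∞}
    (hψ : Measurable ψ) {Ψ : (Fin N → ℝ) → ℝ≥0∞}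
    (hΨ : ∀ e : Fin (q + 1) ↪ Fin N, ∀ᵐ v ∂(Measure.pi fun _ : Fin N => μ), v ∈ bottomEvent e →
      Ψ v = ψ fun i => v (e i)) :
    ∫⁻ v, Ψ v ∂(Measure.pi fun _ : Fin N => μ) = N.descFactorial (q + 1) *
      ∫⁻ w in {w | StrictMono w}, ψ w * μ (Set.Ioi (w (Fin.last q))) ^ (N - (q + 1))
        ∂(Measure.pi fun _ : Fin (q + 1) => μ) := by
  classical
  -- Almost surely there are no ties, so exactly one term of the sum is active. Every e contributes
  -- the same integral, and the number of embeddings is the falling factorial.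
  have h1 : ∀ᵐ v ∂(Measure.pi fun _ : Fin N => μ), Ψ v =
      ∑ e : Fin (q + 1) ↪ Fin N, (bottomEvent e).indicator (fun v => ψ fun i => v (e i)) v := by
    filter_upwards [ae_injective_pi (ι := Fin N) μ, ae_all_iff.2 hΨ] with v hv hv2
    obtain ⟨e, he, huniq⟩ := existsUnique_bottomEvent hq hv
    rw [Finset.sum_eq_single e, Set.indicator_of_mem he, hv2 e he]
    · intro e' _ hne
      exact Set.indicator_of_notMem (fun h => hne (huniq e' h)) _
    · simp
  rw [lintegral_congr_ae h1, lintegral_finsetSum]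
  · simp_rw [lintegral_indicator (measurableSet_bottomEvent _), setLIntegral_bottomEvent _ μ hψ]
    rw [Finset.sum_const, Finset.card_univ, Fintype.card_embedding_eq, Fintype.card_fin,
      Fintype.card_fin, nsmul_eq_mul]
  · intro e _
    exact (hψ.comp (measurable_pi_lambda _ fun i => measurable_pi_apply (e i))).indicator
      (measurableSet_bottomEvent e)

end OrderStatistics

/-! ### The law of partial sums of exponentials. -/

section PartialSums

lemma lintegral_prod_pi_fin {n : ℕ} (f : Fin n → ℝ → ℝ≥0∞) (hf : ∀ i, Measurable (f i)) :
    ∫⁻ x : Fin n → ℝ, ∏ i, f i (x i) = ∏ i, ∫⁻ t, f i t := by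
  induction n with
  | zero => simp [volume_pi]
  | succ n ih =>
    have hmp := volume_preserving_piFinSuccAbove (fun _ : Fin (n + 1) => ℝ) 0
    have hmeas : Measurable fun y : Fin n → ℝ => ∏ i, f i.succ (y i) :=
      Finset.measurable_prod _ fun i _ => (hf i.succ).comp (measurable_pi_apply i)
    let g : ℝ × (Fin n → ℝ) → ℝ≥0∞ := fun p => f 0 p.1 * ∏ i, f i.succ (p.2 i)
    have h1 : ∀ x : Fin (n + 1) → ℝ, ∏ i, f i (x i) =
        g (MeasurableEquiv.piFinSuccAbove (fun _ : Fin (n + 1) => ℝ) 0 x) := by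
      intro x
      rw [Fin.prod_univ_succ]
      rfl
    rw [lintegral_congr h1, hmp.lintegral_comp_emb (MeasurableEquiv.measurableEmbedding _) g,
      Measure.volume_eq_prod,
      lintegral_prod_mul (hf 0).aemeasurable hmeas.aemeasurable, ih _ fun i => hf i.succ,
      Fin.prod_univ_succ]

lemma pi_expMeasure_eq_withDensity (n : ℕ) :
    (Measure.pi fun _ : Fin n => expMeasure 1) =
      (volume : Measure (Fin n → ℝ)).withDensity fun x => ∏ i, exponentialPDF 1 (x i) := by
  have hpdf : Measurable (exponentialPDF 1) := (measurable_exponentialPDFReal 1).ennreal_ofReal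
  have := isProbabilityMeasure_expMeasure one_pos
  refine Measure.pi_eq fun s hs => ?_
  rw [withDensity_apply _ (MeasurableSet.univ_pi hs),
    ← lintegral_indicator (MeasurableSet.univ_pi hs)]
  have h1 : ∀ x : Fin n → ℝ, (Set.univ.pi s).indicator (fun x => ∏ i, exponentialPDF 1 (x i)) x =
      ∏ i, (s i).indicator (exponentialPDF 1) (x i) := by
    intro x
    by_cases hx : x ∈ Set.univ.pi s
    · rw [Set.indicator_of_mem hx]
      exact Finset.prod_congr rfl fun i _ => (Set.indicator_of_mem (hx i trivial) _).symm
    · rw [Set.indicator_of_notMem hx]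
      simp only [Set.mem_pi, Set.mem_univ, forall_true_left, not_forall] at hx
      obtain ⟨i, hi⟩ := hx
      exact (Finset.prod_eq_zero (Finset.mem_univ i) (Set.indicator_of_notMem hi _)).symm
  simp_rw [h1]
  rw [lintegral_prod_pi_fin _ fun i => hpdf.indicator (hs i)]
  refine Finset.prod_congr rfl fun i _ => ?_
  rw [lintegral_indicator (hs i)]
  exact (withDensity_apply _ (hs i)).symm

/-- The strictly increasing tuples of positive reals. -/
def increasingCone (q : ℕ) : Set (Fin (q + 1) → ℝ) := {w | StrictMono w ∧ 0 < w 0}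

lemma measurableSet_increasingCone (q : ℕ) : MeasurableSet (increasingCone q) :=
  (measurableSet_strictMono (q + 1)).inter (measurableSet_lt measurable_const (measurable_pi_apply 0))

lemma pos_of_mem_increasingCone {q : ℕ} {w : Fin (q + 1) → ℝ} (hw : w ∈ increasingCone q)
    (i : Fin (q + 1)) : 0 < w i :=
  hw.2.trans_le (hw.1.monotone (Fin.zero_le i))

lemma sum_Iic_succ {q : ℕ} (x : Fin (q + 1) → ℝ) (i : Fin q) :
    ∑ j ∈ Finset.Iic i.succ, x j = ∑ j ∈ Finset.Iic i.castSucc, x j + x i.succ := by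
  have h : Finset.Iic i.succ = insert i.succ (Finset.Iic i.castSucc) := by
    ext j
    simp only [Finset.mem_Iic, Finset.mem_insert, Fin.le_def, Fin.ext_iff, Fin.val_succ,
      Fin.val_castSucc]
    omega
  rw [h, Finset.sum_insert (by simp [Fin.le_def]), add_comm]

lemma partialSum_mem_increasingCone_iff {q : ℕ} (x : Fin (q + 1) → ℝ) :
    (fun k => ∑ j ∈ Finset.Iic k, x j) ∈ increasingCone q ↔ ∀ i, 0 < x i := by
  have h0 : ∑ j ∈ Finset.Iic (0 : Fin (q + 1)), x j = x 0 := by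
    have : Finset.Iic (0 : Fin (q + 1)) = {0} := by ext j; simp
    rw [this, Finset.sum_singleton]
  have : (fun k => ∑ j ∈ Finset.Iic k, x j) ∈ increasingCone q ↔
      StrictMono (fun k => ∑ j ∈ Finset.Iic k, x j) ∧ 0 < ∑ j ∈ Finset.Iic (0 : Fin (q + 1)), x j :=
    Iff.rfl
  rw [this, h0, Fin.strictMono_iff_lt_succ, Fin.forall_fin_succ, and_comm]
  simp only [sum_Iic_succ, lt_add_iff_pos_right]

/-- Taking partial sums is a lower triangular linear map with unit diagonal, hence of determinant 1.
-/
lemma measurePreserving_partialSum (q : ℕ) :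
    MeasurePreserving (fun (x : Fin (q + 1) → ℝ) k => ∑ j ∈ Finset.Iic k, x j) volume volume := by
  let M : Matrix (Fin (q + 1)) (Fin (q + 1)) ℝ := Matrix.of fun i j => if j ≤ i then 1 else 0
  have hdet : M.det = 1 := by
    rw [Matrix.det_of_isLowerTriangular]
    · simp [M]
    · intro i j hij
      have : i < j := hij
      simp [M, this]
  have hM : (fun (x : Fin (q + 1) → ℝ) k => ∑ j ∈ Finset.Iic k, x j) = Matrix.toLin' M := by
    ext x k
    simp only [Matrix.toLin'_apply, Matrix.mulVec, dotProduct, M, Matrix.of_apply, ite_mul, one_mul,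
      zero_mul, ← Finset.sum_filter]
    congr 1
    ext j; simp
  refine ⟨by fun_prop, ?_⟩
  rw [hM, Real.map_matrix_volume_pi_eq_smul_volume_pi (by simp [hdet])]
  simp [hdet]

/-- The joint law of the first arrival times of a Poisson process. -/
lemma lintegral_partialSum_exponential {q : ℕ} {ψ : (Fin (q + 1) → ℝ) → ℝ≥0∞}
    (hψ : Measurable ψ) :
    ∫⁻ x, ψ (fun k => ∑ j ∈ Finset.Iic k, x j) ∂(Measure.pi fun _ : Fin (q + 1) => expMeasure 1) =
      ∫⁻ w in increasingCone q, ψ w * ENNReal.ofReal (Real.exp (-w (Fin.last q))) := by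
  have hpdf : Measurable (exponentialPDF 1) := (measurable_exponentialPDFReal 1).ennreal_ofReal
  have hmp := measurePreserving_partialSum q
  have hdens : Measurable fun x : Fin (q + 1) → ℝ => ∏ i, exponentialPDF 1 (x i) :=
    Finset.measurable_prod _ fun i _ => hpdf.comp (measurable_pi_apply i)
  have hmeas : Measurable ((increasingCone q).indicator fun w =>
      ψ w * ENNReal.ofReal (Real.exp (-w (Fin.last q)))) :=
    Measurable.indicator (by fun_prop) (measurableSet_increasingCone q)
  have hcomp : Measurable fun x : Fin (q + 1) → ℝ => ψ fun k => ∑ j ∈ Finset.Iic k, x j :=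
    hψ.comp hmp.measurable
  rw [pi_expMeasure_eq_withDensity, lintegral_withDensity_eq_lintegral_mul _ hdens hcomp, ← lintegral_indicator (measurableSet_increasingCone q),
    ← hmp.lintegral_comp hmeas]
  -- The exponential density does not vanish at 0, whereas the cone demands strict positivity; the
  -- discrepancy is a null set.
  have hae : ∀ᵐ x : Fin (q + 1) → ℝ, ∀ i, x i ≠ 0 :=
    ae_all_iff.2 fun i => Measure.ae_eval_ne (fun _ : Fin (q + 1) => (volume : Measure ℝ)) i 0
  refine lintegral_congr_ae ?_
  filter_upwards [hae] with x hx
  simp only [Pi.mul_apply]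
  by_cases hpos : ∀ i, 0 < x i
  · rw [Set.indicator_of_mem ((partialSum_mem_increasingCone_iff x).2 hpos), mul_comm]
    congr 1
    have h1 : ∀ i, exponentialPDF 1 (x i) = ENNReal.ofReal (Real.exp (-x i)) := by
      intro i
      rw [exponentialPDF_of_nonneg (hpos i).le]
      simp
    have h2 : Finset.Iic (Fin.last q) = Finset.univ := by ext j; simp [Fin.le_last]
    beta_reduce
    rw [h2, ← Finset.sum_neg_distrib, Real.exp_sum, ENNReal.ofReal_prod_of_nonneg
      fun i _ => (Real.exp_pos _).le]
    exact Finset.prod_congr rfl fun i _ => h1 i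
  · rw [Set.indicator_of_notMem (mt (partialSum_mem_increasingCone_iff x).1 hpos)]
    push Not at hpos
    obtain ⟨i, hi⟩ := hpos
    rw [Finset.prod_eq_zero (Finset.mem_univ i) (exponentialPDF_of_neg (lt_of_le_of_ne hi (hx i))),
      zero_mul]

end PartialSums

/-! ### Quantile transform of uniforms on (0, N). -/

section UniformRepresentation

/-- The uniform distribution on `(0, N)`. -/
noncomputable def uniformTo (N : ℕ) : Measure ℝ :=
  (N : ℝ≥0∞)⁻¹ • (volume : Measure ℝ).restrict (Set.Ioo 0 (N : ℝ))

lemma isProbabilityMeasure_uniformTo {N : ℕ} (hN : 0 < N) :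
    IsProbabilityMeasure (uniformTo N) := by
  constructor
  have : (N : ℝ≥0∞) ≠ 0 := by exact_mod_cast hN.ne'
  simp [uniformTo, ENNReal.inv_mul_cancel this]

instance (N : ℕ) : NullSingletonClass (uniformTo N) := ⟨fun x => by simp [uniformTo]⟩

lemma uniformTo_Ici {N : ℕ} (hN : 0 < N) {t : ℝ} (ht : t ∈ Set.Icc 0 (N : ℝ)) :
    uniformTo N (Set.Ici t) = ENNReal.ofReal (1 - t / N) := by
  have hN' : (0 : ℝ) < N := by exact_mod_cast hN
  have h1 : volume (Set.Ici t ∩ Set.Ioo 0 (N : ℝ)) = ENNReal.ofReal (N - t) := by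
    apply le_antisymm
    · rw [← Real.volume_Ico]
      exact measure_mono fun x hx => ⟨hx.1, hx.2.2⟩
    · rw [← Real.volume_Ioo]
      exact measure_mono fun x hx => ⟨hx.1.le, ht.1.trans_lt hx.1, hx.2⟩
  rw [uniformTo, Measure.smul_apply, Measure.restrict_apply measurableSet_Ici, h1, smul_eq_mul,
    ← ENNReal.ofReal_natCast, ← ENNReal.ofReal_inv_of_pos hN', ← ENNReal.ofReal_mul (by positivity)]
  congr 1
  field_simp

lemma measurable_quantile_one_sub_div (H : Measure ℝ) (N : ℕ) :
    Measurable fun v : ℝ => (quantile H (1 - v / N)).toReal := by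
  refine measurable_ereal_toReal.comp (Antitone.measurable fun v w hvw => quantile_mono H ?_)
  gcongr

lemma one_sub_div_mem {N : ℕ} {v : ℝ} (hv : v ∈ Set.Ioo 0 (N : ℝ)) :
    0 < 1 - v / N ∧ 1 - v / N < 1 := by
  have hN : (0 : ℝ) < N := hv.1.trans hv.2
  have h1 : v / N < 1 := (div_lt_one hN).2 hv.2
  have h2 : 0 < v / N := div_pos hv.1 hN
  constructor <;> linarith

/-- Outside the open interval the quantile may be infinite, and `toReal` would send it to 0 and
break monotonicity. -/
lemma antitoneOn_quantile_one_sub_div (H : Measure ℝ) (N : ℕ) :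
    AntitoneOn (fun v : ℝ => (quantile H (1 - v / N)).toReal) (Set.Ioo 0 (N : ℝ)) := by
  intro v hv w hw hvw
  have h1 := one_sub_div_mem hv
  have h2 := one_sub_div_mem hw
  simp only
  rw [toReal_quantile_le_iff H h2.1 h2.2]
  refine le_trans ?_ ((toReal_quantile_le_iff H h1.1 h1.2).1 le_rfl)
  gcongr

lemma ae_mem_Ioo_uniformTo (N : ℕ) : ∀ᵐ v ∂(uniformTo N), v ∈ Set.Ioo 0 (N : ℝ) :=
  Measure.ae_smul_measure (ae_restrict_mem measurableSet_Ioo) _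

/-- The quantile transform in decreasing form, so that small v correspond to large observations: by
the Galois connection the event that the image is at most x is, up to a null set, N(1 - H(x)) ≤ v.
-/
lemma map_quantile_uniformTo (H : Measure ℝ) [IsProbabilityMeasure H] {N : ℕ} (hN : 0 < N) :
    (uniformTo N).map (fun v : ℝ => (quantile H (1 - v / N)).toReal) = H := by
  have := isProbabilityMeasure_uniformTo hN
  have hN' : (0 : ℝ) < N := by exact_mod_cast hN
  have hmeas := measurable_quantile_one_sub_div H N
  have := Measure.isProbabilityMeasure_map (μ := uniformTo N) hmeas.aemeasurable
  refine Measure.ext_of_Iic _ _ fun x => ?_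
  rw [Measure.map_apply hmeas measurableSet_Iic, ← ofReal_cdf H x]
  have h0 := cdf_nonneg H x
  have h1 := cdf_le_one H x
  have hset : (fun v : ℝ => (quantile H (1 - v / N)).toReal) ⁻¹' Set.Iic x =ᵐ[uniformTo N]
      Set.Ici (N * (1 - cdf H x)) := by
    filter_upwards [ae_mem_Ioo_uniformTo N] with v hv
    have h2 := one_sub_div_mem hv
    have hiff : (quantile H (1 - v / N)).toReal ≤ x ↔ N * (1 - cdf H x) ≤ v := by
      rw [toReal_quantile_le_iff H h2.1 h2.2, sub_le_comm, le_div_iff₀ hN', mul_comm]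
    exact propext hiff
  rw [measure_congr hset, uniformTo_Ici hN ⟨by nlinarith, by nlinarith⟩]
  congr 1
  field_simp
  ring

lemma pi_uniformTo {N m : ℕ} (hN : 0 < N) :
    (Measure.pi fun _ : Fin m => uniformTo N) = ((N : ℝ≥0∞)⁻¹ ^ m) •
      (volume : Measure (Fin m → ℝ)).restrict (Set.univ.pi fun _ => Set.Ioo 0 (N : ℝ)) := by
  have := isProbabilityMeasure_uniformTo hN
  refine Measure.pi_eq fun s hs => ?_
  rw [volume_pi, Measure.restrict_pi_pi, Measure.smul_apply, Measure.pi_pi]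
  simp only [uniformTo, Measure.smul_apply, smul_eq_mul, Finset.prod_mul_distrib, Finset.prod_const,
    Finset.card_univ, Fintype.card_fin]

/-- The integral of a function of the `q + 1` largest observations of an iid sample. -/
lemma lintegral_topOrderStat (H : Measure ℝ) [IsProbabilityMeasure H] {N q : ℕ} (hq : q < N)
    {f : (Fin (q + 1) → ℝ) → ℝ≥0∞} (hf : Measurable f) :
    ∫⁻ x, f (fun k : Fin (q + 1) => topOrderStat N x k) ∂(Measure.pi fun _ : Fin N => H) =
      (N.descFactorial (q + 1) * (N : ℝ≥0∞)⁻¹ ^ (q + 1)) *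
      ∫⁻ w in increasingCone q, (Set.Iio (N : ℝ)).indicator (fun t =>
        f (fun k => (quantile H (1 - w k / N)).toReal) *
          ENNReal.ofReal (1 - t / N) ^ (N - (q + 1))) (w (Fin.last q)) := by
  have hN : 0 < N := by omega
  have hμ := isProbabilityMeasure_uniformTo hN
  set φ : ℝ → ℝ := fun v => (quantile H (1 - v / N)).toReal with hφ
  have hφm : Measurable φ := measurable_quantile_one_sub_div H N
  have htop : Measurable fun (x : Fin N → ℝ) (k : Fin (q + 1)) => topOrderStat N x k :=
    measurable_pi_lambda _ fun k => measurable_topOrderStat N k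
  have hφw : Measurable fun (w : Fin (q + 1) → ℝ) k => φ (w k) :=
    measurable_pi_lambda _ fun k => hφm.comp (measurable_pi_apply k)
  have hmap : (Measure.pi fun _ : Fin N => uniformTo N).map (fun v i => φ (v i)) =
      Measure.pi fun _ : Fin N => H := by
    have : ∀ i : Fin N, SigmaFinite ((uniformTo N).map φ) := fun _ => by
      rw [map_quantile_uniformTo H hN]; infer_instance
    rw [Measure.pi_map_pi (μ := fun _ : Fin N => uniformTo N) (f := fun _ => φ)
      fun _ => hφm.aemeasurable]
    simp only [hφ, map_quantile_uniformTo H hN]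
  have hftop : Measurable fun x : Fin N → ℝ => f fun k : Fin (q + 1) => topOrderStat N x k :=
    hf.comp htop
  have hφv : Measurable fun (v : Fin N → ℝ) i => φ (v i) :=
    measurable_pi_lambda _ fun k => hφm.comp (measurable_pi_apply k)
  rw [← hmap, lintegral_map hftop hφv,
    lintegral_bottom_coordinates hq (uniformTo N) (hf.comp hφw)]
  · rw [pi_uniformTo hN, Measure.restrict_smul, lintegral_smul_measure, smul_eq_mul, mul_assoc]
    congr 2
    rw [Measure.restrict_restrict (measurableSet_strictMono _),
      ← lintegral_indicator ((measurableSet_strictMono _).inter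
        (MeasurableSet.univ_pi fun _ => measurableSet_Ioo)),
      ← lintegral_indicator (measurableSet_increasingCone q)]
    refine lintegral_congr fun w => ?_
    -- For increasing tuples the box constraint reduces to positivity of the first coordinate and
    -- the bound N on the last.
    have hiff : w ∈ {w : Fin (q + 1) → ℝ | StrictMono w} ∩
        (Set.univ.pi fun _ => Set.Ioo 0 (N : ℝ)) ↔
        w ∈ increasingCone q ∧ w (Fin.last q) < N := by
      constructor
      · rintro ⟨h1, h2⟩
        exact ⟨⟨h1, (h2 0 trivial).1⟩, (h2 (Fin.last q) trivial).2⟩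
      · rintro ⟨h1, h2⟩
        exact ⟨h1.1, fun i _ => ⟨pos_of_mem_increasingCone h1 i,
          (h1.1.monotone (Fin.le_last i)).trans_lt h2⟩⟩
    by_cases h1 : w ∈ increasingCone q
    · by_cases h2 : w (Fin.last q) < N
      · rw [Set.indicator_of_mem (hiff.2 ⟨h1, h2⟩), Set.indicator_of_mem h1,
          Set.indicator_of_mem (show w (Fin.last q) ∈ Set.Iio (N : ℝ) from h2)]
        simp only [Function.comp_apply]
        rw [measure_congr (Ioi_ae_eq_Ici (μ := uniformTo N)), uniformTo_Ici hN
          ⟨(pos_of_mem_increasingCone h1 _).le, h2.le⟩]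
      · rw [Set.indicator_of_notMem fun h => h2 (hiff.1 h).2, Set.indicator_of_mem h1,
          Set.indicator_of_notMem (show w (Fin.last q) ∉ Set.Iio (N : ℝ) from h2)]
    · rw [Set.indicator_of_notMem fun h => h1 (hiff.1 h).1, Set.indicator_of_notMem h1]
  · intro e
    have hae : ∀ᵐ v ∂(Measure.pi fun _ : Fin N => uniformTo N), ∀ i, v i ∈ Set.Ioo 0 (N : ℝ) :=
      ae_all_iff.2 fun i => (measurePreserving_eval (fun _ : Fin N => uniformTo N)
        i).quasiMeasurePreserving.ae (ae_mem_Ioo_uniformTo N)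
    filter_upwards [hae] with v hv hve
    simp only [Function.comp_apply]
    congr 1
    funext k
    exact topOrderStat_of_mem_bottomEvent hve (antitoneOn_quantile_one_sub_div H N) hv k

end UniformRepresentation

/-! ### Passage to the limit by dominated convergence. -/

section Limit

/-- The exponent N - m is at least N/2, which gives an exponential bound independent of N for use as
a dominating function. -/
lemma one_sub_div_pow_le {N m : ℕ} (hmN : 2 * m ≤ N) (hm : 0 < m) {t : ℝ} (ht0 : 0 ≤ t)
    (htN : t < N) : (1 - t / N) ^ (N - m) ≤ Real.exp (-(t / 2)) := by
  have hN : (0 : ℝ) < N := by exact_mod_cast (by omega : 0 < N)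
  have h0 : 0 ≤ 1 - t / N := by rw [sub_nonneg, div_le_one hN]; exact htN.le
  have h1 : 1 - t / N ≤ Real.exp (-(t / N)) := by
    have := Real.add_one_le_exp (-(t / N)); linarith
  have h2 : (N : ℝ) / 2 ≤ (N - m : ℕ) := by
    rw [Nat.cast_sub (by omega)]
    have : (2 : ℝ) * m ≤ N := by exact_mod_cast hmN
    linarith
  calc (1 - t / N) ^ (N - m) ≤ Real.exp (-(t / N)) ^ (N - m) := by gcongr
    _ = Real.exp (-(t / N * (N - m : ℕ))) := by rw [← Real.exp_nat_mul]; ring_nf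
    _ ≤ Real.exp (-(t / 2)) := by
      rw [Real.exp_le_exp, neg_le_neg_iff]
      calc t / 2 = t / N * (N / 2) := by field_simp
        _ ≤ _ := by gcongr

lemma tendsto_one_sub_div_pow_sub (t : ℝ) (m : ℕ) :
    Tendsto (fun N : ℕ => (1 - t / N) ^ (N - m)) atTop (𝓝 (Real.exp (-t))) := by
  have h1 := Real.tendsto_one_add_div_pow_exp (-t)
  have h2 : Tendsto (fun N : ℕ => 1 - t / N) atTop (𝓝 (1 - 0)) :=
    tendsto_const_nhds.sub (tendsto_const_nhds.div_atTop tendsto_natCast_atTop_atTop)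
  rw [sub_zero] at h2
  have h3 := h1.div (h2.pow m) (by simp)
  rw [one_pow, div_one] at h3
  refine h3.congr' ?_
  filter_upwards [eventually_ge_atTop m, h2.eventually (lt_mem_nhds one_pos)] with N hN hpos
  simp only [Pi.div_apply]
  rw [neg_div, ← sub_eq_add_neg, pow_sub₀ _ hpos.ne' hN, div_eq_mul_inv]

lemma tendsto_descFactorial_mul_inv_pow (m : ℕ) :
    Tendsto (fun N : ℕ => (N.descFactorial m : ℝ≥0∞) * (N : ℝ≥0∞)⁻¹ ^ m) atTop (𝓝 1) := by
  have h1 : Tendsto (fun N : ℕ => (N.descFactorial m : ℝ) / (N : ℝ) ^ m) atTop (𝓝 1) := by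
    refine (Asymptotics.isEquivalent_iff_tendsto_one ?_).1 (isEquivalent_descFactorial m)
    filter_upwards [eventually_gt_atTop 0] with N hN
    have : (N : ℝ) ≠ 0 := by exact_mod_cast hN.ne'
    positivity
  have h2 := ENNReal.tendsto_ofReal h1
  rw [ENNReal.ofReal_one] at h2
  refine h2.congr' ?_
  filter_upwards [eventually_gt_atTop 0] with N hN
  have hN' : (0 : ℝ) < N := by exact_mod_cast hN
  rw [ENNReal.ofReal_div_of_pos (by positivity), ENNReal.ofReal_pow hN'.le, ENNReal.ofReal_natCast,
    ENNReal.ofReal_natCast, div_eq_mul_inv, ENNReal.inv_pow]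

/-- The largest observations of a triangular array, iid within rows, converge jointly in
distribution as soon as the normalized tail quantiles converge. -/
theorem tendstoInDistribution_topOrderStat {ι Ω Ω' : Type*} [MeasurableSpace Ω]
    [MeasurableSpace Ω'] {P : Measure Ω} [IsProbabilityMeasure P] {P' : Measure Ω'}
    [IsProbabilityMeasure P'] {l : Filter ι} [l.IsCountablyGenerated]
    {N : ι → ℕ} (hN : Tendsto N l atTop) (H : ι → Measure ℝ) [∀ n, IsProbabilityMeasure (H n)]
    (Y : (n : ι) → Fin (N n) → Ω → ℝ)
    (hY : ∀ n, HasLaw (fun ω i => Y n i ω) (Measure.pi fun _ => H n) P)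
    {A B : ι → ℝ} {g : ℝ → ℝ} (hg : Measurable g)
    (hlim : ∀ v, 0 < v →
      Tendsto (fun n => ((quantile (H n) (1 - v / N n)).toReal - B n) / A n) l (𝓝 (g v)))
    {q : ℕ} {E : Fin (q + 1) → Ω' → ℝ}
    (hE : HasLaw (fun ω i => E i ω) (Measure.pi fun _ => expMeasure 1) P') :
    TendstoInDistribution
      (fun n ω (k : Fin (q + 1)) => (topOrderStat (N n) (fun i => Y n i ω) k - B n) / A n)
      l (fun ω k => g (∑ i ∈ Finset.Iic k, E i ω)) (fun _ => P) P' := by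
  have hnorm : ∀ n, Measurable fun (x : Fin (N n) → ℝ) (k : Fin (q + 1)) =>
      (topOrderStat (N n) x k - B n) / A n := fun n =>
    measurable_pi_lambda _ fun k => ((measurable_topOrderStat (N n) k).sub_const _).div_const _
  have hsum : Measurable fun (x : Fin (q + 1) → ℝ) k => g (∑ i ∈ Finset.Iic k, x i) :=
    measurable_pi_lambda _ fun k => hg.comp (by fun_prop)
  have hm1 : ∀ n, AEMeasurable
      (fun ω (k : Fin (q + 1)) => (topOrderStat (N n) (fun i => Y n i ω) k - B n) / A n) P :=
    fun n => (hnorm n).comp_aemeasurable (hY n).aemeasurable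
  have hm2 : AEMeasurable (fun ω (k : Fin (q + 1)) => g (∑ i ∈ Finset.Iic k, E i ω)) P' :=
    hsum.comp_aemeasurable hE.aemeasurable
  refine ⟨hm1, hm2, ?_⟩
  refine ProbabilityMeasure.tendsto_iff_forall_lintegral_tendsto.2 fun f => ?_
  have hf : Measurable fun x => (f x : ℝ≥0∞) := f.continuous.measurable.coe_nnreal_ennreal
  change Tendsto (fun n => ∫⁻ y, (f y : ℝ≥0∞) ∂(P.map fun ω (k : Fin (q + 1)) =>
    (topOrderStat (N n) (fun i => Y n i ω) k - B n) / A n)) l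
    (𝓝 (∫⁻ y, (f y : ℝ≥0∞) ∂(P'.map fun ω k => g (∑ i ∈ Finset.Iic k, E i ω))))
  have hgw : Measurable fun (w : Fin (q + 1) → ℝ) k => g (w k) :=
    measurable_pi_lambda _ fun k => hg.comp (measurable_pi_apply k)
  have hlimit : ∫⁻ y, (f y : ℝ≥0∞) ∂(P'.map fun ω k => g (∑ i ∈ Finset.Iic k, E i ω)) =
      ∫⁻ w in increasingCone q, f (fun k => g (w k)) *
        ENNReal.ofReal (Real.exp (-w (Fin.last q))) := by
    have h1 : Measurable fun x : Fin (q + 1) → ℝ =>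
        (f fun k => g (∑ i ∈ Finset.Iic k, x i) : ℝ≥0∞) := hf.comp hsum
    rw [lintegral_map' hf.aemeasurable hm2, hE.lintegral_comp h1.aemeasurable]
    exact lintegral_partialSum_exponential (hf.comp hgw)
  have hpre : ∀ n, q < N n → ∫⁻ y, (f y : ℝ≥0∞) ∂(P.map fun ω (k : Fin (q + 1)) =>
      (topOrderStat (N n) (fun i => Y n i ω) k - B n) / A n) =
      ((N n).descFactorial (q + 1) * (N n : ℝ≥0∞)⁻¹ ^ (q + 1)) *
      ∫⁻ w in increasingCone q, (Set.Iio (N n : ℝ)).indicator (fun t =>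
        f (fun k => ((quantile (H n) (1 - w k / N n)).toReal - B n) / A n) *
          ENNReal.ofReal (1 - t / N n) ^ (N n - (q + 1))) (w (Fin.last q)) := by
    intro n hn
    have h1 : Measurable fun x : Fin (N n) → ℝ =>
        (f fun k : Fin (q + 1) => (topOrderStat (N n) x k - B n) / A n : ℝ≥0∞) :=
      hf.comp (hnorm n)
    have h2 : Measurable fun y : Fin (q + 1) → ℝ => (f fun k => (y k - B n) / A n : ℝ≥0∞) :=
      hf.comp (measurable_pi_lambda _ fun k =>
        ((measurable_pi_apply k).sub_const _).div_const _)
    rw [lintegral_map' hf.aemeasurable (hm1 n), (hY n).lintegral_comp h1.aemeasurable]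
    exact lintegral_topOrderStat (H n) hn h2
  rw [hlimit]
  -- Samples of size at most q, where `topOrderStat` takes its default value, are discarded here.
  have hNq := hN.eventually_gt_atTop q
  refine Tendsto.congr' (hNq.mono fun n hn => (hpre n hn).symm) ?_
  rw [← one_mul (∫⁻ w in increasingCone q, _)]
  refine ENNReal.Tendsto.mul ((tendsto_descFactorial_mul_inv_pow (q + 1)).comp hN)
    (Or.inl one_ne_zero) ?_ (Or.inr ENNReal.one_ne_top)
  obtain ⟨C, hC⟩ : ∃ C : NNReal, ∀ x, f x ≤ C :=
    ⟨nndist f 0, fun x => by simpa using f.nndist_coe_le_nndist (g := 0) x⟩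
  -- All q + 1 coordinates are at most the last one, so b times their sum is at most w_last/2. The
  -- bound exp(-w_last/2) is thereby dominated by a product of integrable one-variable functions.
  set b : ℝ := 1 / (2 * (q + 1)) with hb
  have hb0 : 0 < b := by positivity
  let d : ℝ → ℝ≥0∞ := (Set.Ioi 0).indicator fun t => ENNReal.ofReal (Real.exp (-b * t))
  have hd : Measurable d := Measurable.indicator (by fun_prop) measurableSet_Ioi
  refine tendsto_lintegral_filter_of_dominated_convergence (fun w => C * ∏ i, d (w i)) ?_ ?_ ?_ ?_
  · refine Eventually.of_forall fun n => ?_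
    have h1 : Measurable fun w : Fin (q + 1) → ℝ =>
        (f fun k => ((quantile (H n) (1 - w k / N n)).toReal - B n) / A n : ℝ≥0∞) :=
      hf.comp (measurable_pi_lambda _ fun k => (((measurable_quantile_one_sub_div (H n) (N n)).comp
        (measurable_pi_apply k)).sub_const _).div_const _)
    have h2 : MeasurableSet {w : Fin (q + 1) → ℝ | w (Fin.last q) < N n} :=
      measurableSet_lt (measurable_pi_apply _) measurable_const
    have h3 : Measurable fun w : Fin (q + 1) → ℝ =>
        ENNReal.ofReal (1 - w (Fin.last q) / N n) ^ (N n - (q + 1)) := by fun_prop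
    exact (h1.mul h3).indicator h2
  · filter_upwards [hN.eventually_ge_atTop (2 * (q + 1))] with n hn
    filter_upwards [ae_restrict_mem (measurableSet_increasingCone q)] with w hw
    by_cases hwN : w (Fin.last q) < N n
    · rw [Set.indicator_of_mem (show w (Fin.last q) ∈ Set.Iio (N n : ℝ) from hwN)]
      refine mul_le_mul' (by exact_mod_cast hC _) ?_
      have hwpos := pos_of_mem_increasingCone hw
      have h0 : 0 ≤ 1 - w (Fin.last q) / N n := by
        rw [sub_nonneg, div_le_one ((hwpos _).trans hwN)]; exact hwN.le
      have h1 : ∀ i, d (w i) = ENNReal.ofReal (Real.exp (-b * w i)) := fun i =>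
        Set.indicator_of_mem (show w i ∈ Set.Ioi 0 from hwpos i) _
      simp_rw [h1]
      rw [← ENNReal.ofReal_pow h0, ← ENNReal.ofReal_prod_of_nonneg fun i _ => (Real.exp_pos _).le,
        ← Real.exp_sum]
      refine ENNReal.ofReal_le_ofReal ((one_sub_div_pow_le hn (by omega) (hwpos _).le hwN).trans ?_)
      rw [Real.exp_le_exp, ← Finset.mul_sum, neg_mul, neg_le_neg_iff]
      calc b * ∑ i, w i ≤ b * ∑ _i : Fin (q + 1), w (Fin.last q) := by
            gcongr with i
            exact hw.1.monotone (Fin.le_last i)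
        _ = w (Fin.last q) / 2 := by
            rw [Finset.sum_const, Finset.card_univ, Fintype.card_fin, nsmul_eq_mul, hb]
            push_cast
            field_simp
    · rw [Set.indicator_of_notMem (show w (Fin.last q) ∉ Set.Iio (N n : ℝ) from hwN)]
      exact zero_le
  · refine ne_of_lt (lt_of_le_of_lt (setLIntegral_le_lintegral _ _) ?_)
    have hprod : Measurable fun w : Fin (q + 1) → ℝ => ∏ i, d (w i) :=
      Finset.measurable_prod _ fun i _ => hd.comp (measurable_pi_apply i)
    rw [lintegral_const_mul _ hprod, lintegral_prod_pi_fin (fun _ => d) fun _ => hd]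
    refine ENNReal.mul_lt_top ENNReal.coe_lt_top (ENNReal.prod_lt_top fun i _ => ?_)
    rw [lintegral_indicator measurableSet_Ioi]
    exact (exp_neg_integrableOn_Ioi 0 hb0).lintegral_lt_top
  · filter_upwards [ae_restrict_mem (measurableSet_increasingCone q)] with w hw
    have hwpos := pos_of_mem_increasingCone hw
    have hN' : Tendsto (fun n => (N n : ℝ)) l atTop := tendsto_natCast_atTop_atTop.comp hN
    have h1 : Tendsto (fun n => (f (fun k => ((quantile (H n) (1 - w k / N n)).toReal - B n) / A n)
        : ℝ≥0∞)) l (𝓝 (f fun k => g (w k))) :=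
      (ENNReal.continuous_coe.comp f.continuous).continuousAt.tendsto.comp
        (tendsto_pi_nhds.2 fun k => hlim (w k) (hwpos k))
    have h2 : Tendsto (fun n => ENNReal.ofReal ((1 - w (Fin.last q) / N n) ^ (N n - (q + 1)))) l
        (𝓝 (ENNReal.ofReal (Real.exp (-w (Fin.last q))))) :=
      ENNReal.tendsto_ofReal ((tendsto_one_sub_div_pow_sub _ (q + 1)).comp hN)
    refine (ENNReal.Tendsto.mul h1 (Or.inr ENNReal.ofReal_ne_top) h2
      (Or.inr ENNReal.coe_ne_top)).congr' ?_
    filter_upwards [hN'.eventually_gt_atTop (w (Fin.last q))] with n hn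
    rw [Set.indicator_of_mem (show w (Fin.last q) ∈ Set.Iio (N n : ℝ) from hn),
      ENNReal.ofReal_pow]
    rw [sub_nonneg, div_le_one ((hwpos _).trans hn)]
    exact hn.le

end Limit

/-! ### Makarov bounds and tail equivalence. -/

section Noise

/-- The weak inequality is what remains true at r = 0, the left endpoint; the lower Makarov bound
needs it there, since u = 0 is allowed. -/
lemma cdf_le_of_lt_quantile {F : Measure ℝ} {r y : ℝ} (hr : 0 ≤ r) (hy : (y : EReal) < quantile F r) :
    cdf F y ≤ r := by
  by_contra! h
  exact absurd hy (not_lt.2 (iInf₂_le y ⟨h.le, hr.trans_lt h⟩))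

lemma cdf_lt_of_lt_quantile {F : Measure ℝ} {r y : ℝ} (hr : 0 < r) (hy : (y : EReal) < quantile F r) :
    cdf F y < r := by
  by_contra! h
  exact absurd hy (not_lt.2 (iInf₂_le y ⟨h, hr.trans_le h⟩))

/-- Right continuity suffices here, with no restriction on r; the case r = 1 is needed when the
upper Makarov bound touches a right endpoint. -/
lemma le_cdf_of_quantile_le {F : Measure ℝ} {r q : ℝ} (hq : quantile F r ≤ q) : r ≤ cdf F q := by
  by_contra! h
  have hc : Tendsto (cdf F) (𝓝[>] q) (𝓝 (cdf F q)) :=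
    ((cdf F).right_continuous q).mono_left (nhdsWithin_mono _ Set.Ioi_subset_Ici_self)
  have h2 : ∀ᶠ y in 𝓝[>] q, q < y := self_mem_nhdsWithin
  obtain ⟨y, hqy, hy⟩ := (h2.and (hc.eventually (gt_mem_nhds h))).exists
  have : (y : EReal) ≤ quantile F r := by
    refine le_iInf₂ fun x hx => EReal.coe_le_coe_iff.2 ?_
    by_contra! hxy
    exact absurd (hx.1.trans (monotone_cdf F hxy.le)) (not_le.2 hy)
  exact absurd (EReal.coe_le_coe_iff.1 (this.trans hq)) (not_le.2 hqy)

variable {Ω : Type*} [MeasurableSpace Ω] {P : Measure Ω} [IsProbabilityMeasure P]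
  {F G H : Measure ℝ} {X Y : Ω → ℝ} {t : ℝ}

lemma cdf_eq_of_hasLaw (hX : HasLaw X F P) (x : ℝ) : cdf F x = P.real {ω | X ω ≤ x} := by
  have := hX.isProbabilityMeasure_iff.1 ‹_›
  rw [cdf_eq_real]
  exact (hX.measureReal_eq (p := fun y => y ≤ x) measurableSet_Iic).symm

lemma one_sub_cdf_eq_of_hasLaw (hX : HasLaw X F P) (x : ℝ) :
    1 - cdf F x = P.real {ω | x < X ω} := by
  have := hX.isProbabilityMeasure_iff.1 ‹_›
  rw [cdf_eq_real, ← probReal_compl_eq_one_sub measurableSet_Iic, Set.compl_Iic]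
  exact (hX.measureReal_eq (p := fun y => x < y) measurableSet_Ioi).symm

/-- Makarov's lower bound for the quantile function of a sum. -/
lemma add_le_quantile_add (hX : HasLaw X F P) (hY : HasLaw Y G P)
    (hZ : HasLaw (fun ω => X ω + t * Y ω) H P) (ht : 0 < t) {r u : ℝ} (hu : 0 ≤ u) (hur : u < r)
    (hr : r < 1) {x y : ℝ} (hx : quantile F (r - u) = x) (hy : quantile G u = y) :
    x + t * y ≤ (quantile H r).toReal := by
  rw [← not_lt]
  intro hlt
  have hr0 : 0 < r := hu.trans_lt hur
  obtain ⟨z, hz1, hz2⟩ := exists_between hlt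
  -- The slack is shared so that z = (x - κ) + t(y - κ). Then X + tY ≤ z forces X ≤ x - κ or Y ≤ y -
  -- κ, of total probability below (r - u) + u = r. A positive κ is needed because the cdfs may jump
  -- at x and y.
  set κ := (x + t * y - z) / (1 + t) with hκ
  have hκ0 : 0 < κ := by have : 0 < x + t * y - z := by linarith
                         positivity
  have hz : z = (x - κ) + t * (y - κ) := by rw [hκ]; field_simp; ring
  have h1 : cdf F (x - κ) < r - u := cdf_lt_of_lt_quantile (by linarith) (by
    rw [hx]; exact EReal.coe_lt_coe_iff.2 (by linarith))
  have h2 : cdf G (y - κ) ≤ u := cdf_le_of_lt_quantile hu (by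
    rw [hy]; exact EReal.coe_lt_coe_iff.2 (by linarith))
  have h3 : cdf H z ≤ cdf F (x - κ) + cdf G (y - κ) := by
    rw [cdf_eq_of_hasLaw hX, cdf_eq_of_hasLaw hY, cdf_eq_of_hasLaw hZ]
    refine le_trans (measureReal_mono ?_) (measureReal_union_le _ _)
    intro ω hω
    by_contra hnot
    simp only [Set.mem_union, Set.mem_ofPred_eq, not_or, not_le] at hnot hω
    have := mul_lt_mul_of_pos_left hnot.2 ht
    linarith [hnot.1]
  have h4 := (toReal_quantile_le_iff H hr0 hr).1 hz1.le
  linarith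

/-- Makarov's upper bound for the quantile function of a sum. -/
lemma quantile_add_le_add (hX : HasLaw X F P) (hY : HasLaw Y G P)
    (hZ : HasLaw (fun ω => X ω + t * Y ω) H P) (ht : 0 < t) {r u : ℝ} (hr0 : 0 < r) (hr : r < 1)
    {x y : ℝ} (hx : quantile F (r + u) = x) (hy : quantile G (1 - u) = y) :
    (quantile H r).toReal ≤ x + t * y := by
  rw [toReal_quantile_le_iff H hr0 hr]
  have h1 := le_cdf_of_quantile_le hx.le
  have h2 := le_cdf_of_quantile_le hy.le
  have h3 : 1 - cdf H (x + t * y) ≤ (1 - cdf F x) + (1 - cdf G y) := by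
    rw [one_sub_cdf_eq_of_hasLaw hX, one_sub_cdf_eq_of_hasLaw hY, one_sub_cdf_eq_of_hasLaw hZ]
    refine le_trans (measureReal_mono ?_) (measureReal_union_le _ _)
    intro ω hω
    by_contra hnot
    simp only [Set.mem_union, Set.mem_ofPred_eq, not_or, not_lt] at hnot hω
    have := mul_le_mul_of_nonneg_left hnot.2 ht.le
    linarith [hnot.1]
  linarith

lemma quantile_lt_top {F : Measure ℝ} {r : ℝ} (hr : r < 1) : quantile F r < ⊤ := by
  have h := quantile_mono F (le_max_left r (1 / 2))
  rw [← coe_toReal_quantile F (lt_max_of_lt_right (by norm_num)) (max_lt hr (by norm_num))] at h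
  exact h.trans_lt (EReal.coe_lt_top _)

lemma bot_lt_quantile {F : Measure ℝ} {r : ℝ} (hr : 0 < r) : ⊥ < quantile F r := by
  have h := quantile_mono F (min_le_left r (1 / 2))
  rw [← coe_toReal_quantile F (lt_min hr (by norm_num)) (min_lt_of_right_lt (by norm_num))] at h
  exact (EReal.bot_lt_coe _).trans_le h

lemma sub_le_quantile_of_tailSup (hX : HasLaw X F P) (hY : HasLaw Y G P) {p : ℝ} {N T : ℕ}
    (hT : 0 < T) (hZ : HasLaw (fun ω => X ω + 1 / (T : ℝ) ^ p * Y ω) H P) {a τ η δ : ℝ}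
    (ha : a ≠ 0) (hNτ : 1 < N * τ) (hη0 : 0 ≤ η) (hη : η < 1 - 1 / (N * τ))
    (h1 : ((-δ : ℝ) : EReal) < tailSup F G a p τ η N T) (h2 : tailSup F G a p τ η N T < (δ : ℝ)) :
    (quantile F (1 - 1 / (N * τ))).toReal - δ * |a| ≤ (quantile H (1 - 1 / (N * τ))).toReal := by
  obtain ⟨hr0, hr1⟩ := one_sub_one_div_mem hNτ
  set r := 1 - 1 / (N * τ) with hr
  set t := 1 / (T : ℝ) ^ p with htdef
  have ht : 0 < t := by positivity
  have hQ := coe_toReal_quantile F hr0 hr1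
  set Q := (quantile F r).toReal
  let term : ℝ → EReal := fun u => ((1 / a : ℝ) : EReal) *
    (quantile F (r - u) - quantile F r + (t : EReal) * quantile G u)
  -- The sign of a is arbitrary. If a > 0 a nearly optimal u is used; if a < 0 division reverses
  -- inequalities, and the upper bound on the supremum already makes u = 0 good enough.
  have hterm : ∃ u ∈ Set.Icc 0 η,
      (0 < a → ((-δ : ℝ) : EReal) < term u) ∧ (a < 0 → term u < (δ : ℝ)) := by
    rcases lt_or_gt_of_ne ha with ha | ha
    · refine ⟨0, ⟨le_rfl, hη0⟩, fun h => absurd ha h.not_gt, fun _ => lt_of_le_of_lt ?_ h2⟩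
      exact le_iSup₂ (f := fun u (_ : u ∈ Set.Icc 0 η) => term u) 0 ⟨le_rfl, hη0⟩
    · obtain ⟨u, hu⟩ := lt_iSup_iff.1 h1
      obtain ⟨hu1, hu2⟩ := lt_iSup_iff.1 hu
      exact ⟨u, hu1, fun _ => hu2, fun h => absurd ha h.not_gt⟩
  obtain ⟨u, hu, hpos, hneg⟩ := hterm
  have hx := (coe_toReal_quantile F (r := r - u) (by linarith [hu.2]) (by linarith [hu.1])).symm
  set x := (quantile F (r - u)).toReal
  -- At u = 0 the left endpoint of G may be -∞; the term would then be infinite on the side excluded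
  -- by the choice of u.
  have hybot : quantile G u ≠ ⊥ := by
    intro hbot
    have hsum : quantile F (r - u) - quantile F r + (t : EReal) * quantile G u = ⊥ := by
      rw [hbot, EReal.coe_mul_bot_of_pos ht, EReal.add_bot]
    rcases lt_or_gt_of_ne ha with ha | ha
    · have := hneg ha
      simp only [term, hsum] at this
      rw [EReal.coe_mul_bot_of_neg (one_div_neg.2 ha)] at this
      exact absurd this not_top_lt
    · have := hpos ha
      simp only [term, hsum] at this
      rw [EReal.coe_mul_bot_of_pos (one_div_pos.2 ha)] at this
      exact absurd this not_lt_bot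
  have hytop : quantile G u ≠ ⊤ := (quantile_lt_top (by linarith [hu.2])).ne
  have hy := (EReal.coe_toReal hytop hybot).symm
  set y := (quantile G u).toReal
  have hval : term u = ((1 / a * (x - Q + t * y) : ℝ) : EReal) := by
    simp only [term]
    rw [hx, hy, ← hQ]
    norm_cast
  have hmain := add_le_quantile_add hX hY hZ ht hu.1 (by linarith [hu.2]) hr1 hx hy
  refine le_trans ?_ hmain
  rcases lt_or_gt_of_ne ha with ha | ha
  · have := hneg ha
    rw [hval, EReal.coe_lt_coe_iff, one_div_mul_eq_div, div_lt_iff_of_neg ha] at this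
    rw [abs_of_neg ha]; linarith
  · have := hpos ha
    rw [hval, EReal.coe_lt_coe_iff, one_div_mul_eq_div, lt_div_iff₀ ha] at this
    rw [abs_of_pos ha]; linarith

lemma quantile_le_add_of_tailInf (hX : HasLaw X F P) (hY : HasLaw Y G P) {p : ℝ} {N T : ℕ}
    (hT : 0 < T) (hZ : HasLaw (fun ω => X ω + 1 / (T : ℝ) ^ p * Y ω) H P) {a τ δ : ℝ}
    (ha : a ≠ 0) (hNτ : 1 < N * τ)
    (h1 : ((-δ : ℝ) : EReal) < tailInf F G a p τ N T) (h2 : tailInf F G a p τ N T < (δ : ℝ)) :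
    (quantile H (1 - 1 / (N * τ))).toReal ≤ (quantile F (1 - 1 / (N * τ))).toReal + δ * |a| := by
  obtain ⟨hr0, hr1⟩ := one_sub_one_div_mem hNτ
  have hη0 : 0 ≤ 1 / (N * τ) := by linarith
  set η := 1 / (N * τ)
  set r := 1 - η with hr
  set t := 1 / (T : ℝ) ^ p with htdef
  have ht : 0 < t := by positivity
  have hQ := coe_toReal_quantile F hr0 hr1
  set Q := (quantile F r).toReal
  let term : ℝ → EReal := fun u => ((1 / a : ℝ) : EReal) *
    (quantile F (r + u) - quantile F r + (t : EReal) * quantile G (1 - u))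
  have hterm : ∃ u ∈ Set.Icc 0 η,
      (0 < a → term u < (δ : ℝ)) ∧ (a < 0 → ((-δ : ℝ) : EReal) < term u) := by
    rcases lt_or_gt_of_ne ha with ha | ha
    · refine ⟨0, ⟨le_rfl, hη0⟩, fun h => absurd ha h.not_gt, fun _ => lt_of_lt_of_le h1 ?_⟩
      exact iInf₂_le (f := fun u (_ : u ∈ Set.Icc 0 η) => term u) 0 ⟨le_rfl, hη0⟩
    · obtain ⟨u, hu⟩ := iInf_lt_iff.1 h2
      obtain ⟨hu1, hu2⟩ := iInf_lt_iff.1 hu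
      exact ⟨u, hu1, fun _ => hu2, fun h => absurd ha h.not_gt⟩
  obtain ⟨u, hu, hpos, hneg⟩ := hterm
  have hxbot : quantile F (r + u) ≠ ⊥ := (bot_lt_quantile (by linarith [hu.1])).ne'
  have hybot : quantile G (1 - u) ≠ ⊥ := (bot_lt_quantile (by linarith [hu.2])).ne'
  have hdiffbot : quantile F (r + u) - quantile F r ≠ ⊥ := by
    rw [← hQ, sub_eq_add_neg, ← EReal.coe_neg]
    simp [EReal.add_eq_bot_iff, hxbot]
  have hmulbot : (t : EReal) * quantile G (1 - u) ≠ ⊥ := by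
    by_cases hytop : quantile G (1 - u) = ⊤
    · rw [hytop, EReal.coe_mul_top_of_pos ht]; exact bot_ne_top.symm
    · rw [← EReal.coe_toReal hytop hybot, ← EReal.coe_mul]; exact EReal.coe_ne_bot _
  -- A right endpoint may be +∞ when r + u = 1 or u = 0. Neither summand is -∞, so an infinite
  -- endpoint would make the whole sum +∞, and this is excluded.
  have hsum : quantile F (r + u) - quantile F r + (t : EReal) * quantile G (1 - u) ≠ ⊤ := by
    intro hsum
    rcases lt_or_gt_of_ne ha with ha | ha
    · have := hneg ha
      simp only [term, hsum] at this
      rw [EReal.coe_mul_top_of_neg (one_div_neg.2 ha)] at this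
      exact absurd this not_lt_bot
    · have := hpos ha
      simp only [term, hsum] at this
      rw [EReal.coe_mul_top_of_pos (one_div_pos.2 ha)] at this
      exact absurd this not_top_lt
  have hxtop : quantile F (r + u) ≠ ⊤ := by
    intro htop
    refine hsum ?_
    rw [htop, ← hQ, EReal.top_sub_coe, EReal.top_add_of_ne_bot hmulbot]
  have hytop : quantile G (1 - u) ≠ ⊤ := by
    intro htop
    refine hsum ?_
    rw [htop, EReal.coe_mul_top_of_pos ht, EReal.add_top_of_ne_bot hdiffbot]
  have hx := (EReal.coe_toReal hxtop hxbot).symm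
  have hy := (EReal.coe_toReal hytop hybot).symm
  set x := (quantile F (r + u)).toReal
  set y := (quantile G (1 - u)).toReal
  have hval : term u = ((1 / a * (x - Q + t * y) : ℝ) : EReal) := by
    simp only [term]
    rw [hx, hy, ← hQ]
    norm_cast
  have hmain := quantile_add_le_add hX hY hZ ht hr0 hr1 hx hy
  refine hmain.trans ?_
  rcases lt_or_gt_of_ne ha with ha | ha
  · have := hneg ha
    rw [hval, EReal.coe_lt_coe_iff, one_div_mul_eq_div, lt_div_iff_of_neg ha] at this
    rw [abs_of_neg ha]; linarith
  · have := hpos ha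
    rw [hval, EReal.coe_lt_coe_iff, one_div_mul_eq_div, div_lt_iff₀ ha] at this
    rw [abs_of_pos ha]; linarith

end Noise

/-! ### Comparing the scales a_N and α_N. -/

section Scale

/-- If no two separated half-lines both carried mass, both sides of the median m would be null and
the law would be concentrated at m. -/
lemma exists_lt_of_not_ae_const {μ : Measure ℝ} [IsProbabilityMeasure μ]
    (h : ¬ ∃ c : ℝ, ∀ᵐ x ∂μ, x = c) :
    ∃ c d : ℝ, c < d ∧ μ (Set.Iio c) ≠ 0 ∧ μ (Set.Ioi d) ≠ 0 := by
  have hq : ∀ x, (quantile μ (1 / 2)).toReal ≤ x ↔ 1 / 2 ≤ cdf μ x := fun x =>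
    toReal_quantile_le_iff μ (by norm_num) (by norm_num)
  set m := (quantile μ (1 / 2)).toReal
  by_contra! hcon
  refine h ⟨m, ?_⟩
  have h1 : μ (Set.Iio m) = 0 := by
    obtain ⟨u, -, hum, hu⟩ := exists_seq_strictMono_tendsto m
    have hunion : Set.Iio m = ⋃ n, Set.Iio (u n) := by
      ext x
      simp only [Set.mem_Iio, Set.mem_iUnion]
      exact ⟨fun hx => (hu.eventually (lt_mem_nhds hx)).exists, fun ⟨n, hn⟩ => hn.trans (hum n)⟩
    rw [hunion]
    refine measure_iUnion_null fun n => ?_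
    by_contra hne
    obtain ⟨d, hd1, hd2⟩ := exists_between (hum n)
    have h2 := hcon _ d hd1 hne
    have h3 : ¬ 1 / 2 ≤ cdf μ d := fun hle => absurd ((hq d).2 hle) (not_le.2 hd2)
    have h4 := probReal_compl_eq_one_sub (μ := μ) (measurableSet_Iic (a := d))
    rw [Set.compl_Iic, measureReal_def, h2, ENNReal.toReal_zero, ← cdf_eq_real] at h4
    exact h3 (by linarith)
  have h2 : μ (Set.Ioi m) = 0 := by
    obtain ⟨u, -, hum, hu⟩ := exists_seq_strictAnti_tendsto m
    have hunion : Set.Ioi m = ⋃ n, Set.Ioi (u n) := by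
      ext x
      simp only [Set.mem_Ioi, Set.mem_iUnion]
      exact ⟨fun hx => (hu.eventually (gt_mem_nhds hx)).exists, fun ⟨n, hn⟩ => (hum n).trans hn⟩
    rw [hunion]
    refine measure_iUnion_null fun n => ?_
    by_contra hne
    obtain ⟨c, hc1, hc2⟩ := exists_between (hum n)
    refine hne (hcon c _ hc2 fun h0 => ?_)
    have h3 : μ.real (Set.Iic m) = 0 :=
      measureReal_mono_null (Set.Iic_subset_Iio.2 hc1) (by rw [measureReal_def, h0]; rfl)
    have h4 := (hq m).1 le_rfl
    rw [cdf_eq_real, h3] at h4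
    norm_num at h4
  have h3 : μ ({m}ᶜ) = 0 := by
    rw [← Set.Iio_union_Ioi]
    exact measure_union_null h1 h2
  exact h3

lemma eventually_lt_measureReal_of_tendstoInDistribution {Ω Ω' : Type*} [MeasurableSpace Ω]
    [MeasurableSpace Ω'] {P : Measure Ω} [IsProbabilityMeasure P] {P' : Measure Ω'}
    [IsProbabilityMeasure P'] {Y : ℕ → Ω → ℝ} {X : Ω' → ℝ}
    (h : TendstoInDistribution Y atTop X (fun _ => P) P') {s : Set ℝ} (hs : IsOpen s)
    (hpos : (P'.map X) s ≠ 0) : ∃ ρ > 0, ∀ᶠ N in atTop, ρ < P.real {ω | Y N ω ∈ s} := by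
  have h1 := ProbabilityMeasure.le_liminf_measure_open_of_tendsto h.tendsto hs
  change (P'.map X) s ≤ liminf (fun N => (P.map (Y N)) s) atTop at h1
  obtain ⟨ρ, hρ0, hρ⟩ := exists_between (pos_iff_ne_zero.2 hpos)
  have hρtop : ρ ≠ ⊤ := (hρ.trans_le le_top).ne
  refine ⟨ρ.toReal, ENNReal.toReal_pos hρ0.ne' hρtop, ?_⟩
  filter_upwards [eventually_lt_of_lt_liminf (hρ.trans_le h1)] with N hN
  rw [Measure.map_apply_of_aemeasurable (h.forall_aemeasurable N) hs.measurableSet] at hN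
  exact (ENNReal.toReal_lt_toReal hρtop (measure_ne_top _ _)).2 hN

/-- If `M N` is tight after normalization by `α N`, `β N` and converges to a nondegenerate limit
after normalization by `a N`, `b N`, then `a N = O(α N)`. -/
lemma exists_abs_le_mul_of_tendstoInDistribution {Ω Ω' : Type*} [MeasurableSpace Ω]
    [MeasurableSpace Ω'] {P : Measure Ω} [IsProbabilityMeasure P] {P' : Measure Ω'}
    [IsProbabilityMeasure P'] {M : ℕ → Ω → ℝ} {X : Ω' → ℝ} {a b α β : ℕ → ℝ} (ha : ∀ N, a N ≠ 0)
    (hX : TendstoInDistribution (fun N ω => (M N ω - b N) / a N) atTop X (fun _ => P) P')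
    (hX_nondeg : ¬ ∃ c : ℝ, ∀ᵐ ω ∂P', X ω = c)
    (htight : ∀ ρ : ℝ, 0 < ρ → ∃ y z, ∀ᶠ N in atTop, P.real {ω | M N ω ≤ α N * y + β N} +
      P.real {ω | α N * z + β N < M N ω} < ρ) :
    ∃ C, ∀ᶠ N in atTop, |a N| ≤ C * α N := by
  have := Measure.isProbabilityMeasure_map hX.aemeasurable_limit
  have hnd : ¬ ∃ c : ℝ, ∀ᵐ x ∂(P'.map X), x = c := by
    rintro ⟨c, hc⟩
    exact hX_nondeg ⟨c, ae_of_ae_map hX.aemeasurable_limit hc⟩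
  obtain ⟨c, d, hcd, hc, hd⟩ := exists_lt_of_not_ae_const hnd
  obtain ⟨ρ₁, hρ₁, h1⟩ := eventually_lt_measureReal_of_tendstoInDistribution hX isOpen_Iio hc
  obtain ⟨ρ₂, hρ₂, h2⟩ := eventually_lt_measureReal_of_tendstoInDistribution hX isOpen_Ioi hd
  obtain ⟨y, z, hyz⟩ := htight (min ρ₁ ρ₂) (lt_min hρ₁ hρ₂)
  -- An event more likely than leaving the tight window must contain a point at which the maximum
  -- lies inside the window.
  have key : ∀ N (s : Set Ω), P.real {ω | M N ω ≤ α N * y + β N} +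
      P.real {ω | α N * z + β N < M N ω} < P.real s →
      ∃ ω ∈ s, α N * y + β N < M N ω ∧ M N ω ≤ α N * z + β N := by
    intro N s hs
    by_contra! hcon
    refine absurd hs (not_lt.2 ((measureReal_mono ?_).trans (measureReal_union_le _ _)))
    intro ω hω
    by_contra hnot
    simp only [Set.mem_union, Set.mem_ofPred_eq, not_or, not_le, not_lt] at hnot
    exact absurd (hcon ω hω hnot.1) (not_lt.2 hnot.2)
  refine ⟨(z - y) / (d - c), ?_⟩
  filter_upwards [h1, h2, hyz] with N h1 h2 h3
  obtain ⟨ω₁, hω₁, hl₁, hu₁⟩ := key N _ ((h3.trans_le (min_le_left _ _)).trans h1)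
  obtain ⟨ω₂, hω₂, hl₂, hu₂⟩ := key N _ ((h3.trans_le (min_le_right _ _)).trans h2)
  -- Both values lie in a window of length (z - y)α_N, yet they differ by more than (d - c)|a_N|;
  -- this is the required comparison.
  have hgap : d - c < (M N ω₂ - M N ω₁) / a N := by
    have e1 : (M N ω₁ - b N) / a N < c := hω₁
    have e2 : d < (M N ω₂ - b N) / a N := hω₂
    have e3 : (M N ω₂ - M N ω₁) / a N = (M N ω₂ - b N) / a N - (M N ω₁ - b N) / a N := by
      rw [← sub_div]; ring
    linarith
  have hdc : 0 < d - c := by linarith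
  have habs : 0 < |a N| := abs_pos.2 (ha N)
  have h4 : (d - c) * |a N| ≤ (z - y) * α N := by
    have e1 : d - c < |M N ω₂ - M N ω₁| / |a N| := by
      rw [← abs_div]; exact hgap.trans_le (le_abs_self _)
    rw [lt_div_iff₀ habs] at e1
    refine e1.le.trans (abs_le.2 ⟨?_, ?_⟩) <;> linarith
  rw [div_mul_eq_mul_div, le_div_iff₀ hdc]
  linarith

lemma measureReal_topOrderStat_zero_le {Ω : Type*} [MeasurableSpace Ω] {P : Measure Ω}
    {F : Measure ℝ} [IsProbabilityMeasure F] {N : ℕ} (hN : 0 < N) {Y : Fin N → Ω → ℝ}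
    (hY : HasLaw (fun ω i => Y i ω) (Measure.pi fun _ => F) P) (x : ℝ) :
    P.real {ω | topOrderStat N (fun i => Y i ω) 0 ≤ x} = cdf F x ^ N := by
  have hm : MeasurableSet {v : Fin N → ℝ | topOrderStat N v 0 ≤ x} :=
    measurableSet_le (measurable_topOrderStat N 0) measurable_const
  have hset : {v : Fin N → ℝ | topOrderStat N v 0 ≤ x} = Set.univ.pi fun _ => Set.Iic x := by
    ext v
    simp [topOrderStat_le_iff_forall hN, Pi.le_def]
  rw [hY.measureReal_eq hm, hset, measureReal_def, Measure.pi_pi, ENNReal.toReal_prod, cdf_eq_real]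
  simp [measureReal_def]

lemma measureReal_lt_topOrderStat_zero {Ω : Type*} [MeasurableSpace Ω] {P : Measure Ω}
    {F : Measure ℝ} [IsProbabilityMeasure F] {N : ℕ} (hN : 0 < N) {Y : Fin N → Ω → ℝ}
    (hY : HasLaw (fun ω i => Y i ω) (Measure.pi fun _ => F) P) (x : ℝ) :
    P.real {ω | x < topOrderStat N (fun i => Y i ω) 0} = 1 - cdf F x ^ N := by
  have hm : MeasurableSet {v : Fin N → ℝ | topOrderStat N v 0 ≤ x} :=
    measurableSet_le (measurable_topOrderStat N 0) measurable_const
  have hm' : MeasurableSet {v : Fin N → ℝ | x < topOrderStat N v 0} :=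
    measurableSet_lt measurable_const (measurable_topOrderStat N 0)
  rw [← measureReal_topOrderStat_zero_le hN hY x, hY.measureReal_eq hm, hY.measureReal_eq hm',
    ← probReal_compl_eq_one_sub hm]
  congr 1
  ext v
  simp

/-- Tightness of normalized maxima in a domain of attraction. -/
lemma tight_topOrderStat_zero {Ω : Type*} [MeasurableSpace Ω] {P : Measure Ω}
    {F : Measure ℝ} [IsProbabilityMeasure F] {Y : ℕ → Ω → ℝ}
    (hY : ∀ N : ℕ, HasLaw (fun ω (i : Fin N) => Y i ω) (Measure.pi fun _ => F) P)
    {γ : ℝ} {α β : ℕ → ℝ}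
    (h : ∀ x : ℝ, Tendsto (fun N : ℕ => cdf F (α N * x + β N) ^ N) atTop (𝓝 (gevCdf γ x)))
    {ρ : ℝ} (hρ : 0 < ρ) :
    ∃ y z, ∀ᶠ N : ℕ in atTop,
      P.real {ω | topOrderStat N (fun i : Fin N => Y i ω) 0 ≤ α N * y + β N} +
      P.real {ω | α N * z + β N < topOrderStat N (fun i : Fin N => Y i ω) 0} < ρ := by
  have hρ2 : 0 < ρ / 2 := by positivity
  obtain ⟨s, hs0, hs⟩ : ∃ s : ℝ, 0 < s ∧ Real.exp (-1 / s) < ρ / 2 := by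
    have h1 : Tendsto (fun u : ℝ => Real.exp (-u)) atTop (𝓝 0) :=
      Real.tendsto_exp_atBot.comp tendsto_neg_atTop_atBot
    obtain ⟨u, hu0, hu⟩ := ((eventually_gt_atTop 0).and (h1.eventually (gt_mem_nhds hρ2))).exists
    exact ⟨1 / u, by positivity, by simpa [neg_div] using hu⟩
  obtain ⟨t, ht0, ht⟩ : ∃ t : ℝ, 0 < t ∧ 1 - Real.exp (-1 / t) < ρ / 2 := by
    have h1 : Tendsto (fun t : ℝ => 1 - Real.exp (-1 / t)) atTop (𝓝 (1 - Real.exp 0)) :=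
      tendsto_const_nhds.sub
        ((Real.continuous_exp.tendsto 0).comp (tendsto_const_nhds.div_atTop tendsto_id))
    rw [Real.exp_zero, sub_self] at h1
    exact ((eventually_gt_atTop 0).and (h1.eventually (gt_mem_nhds hρ2))).exists
  refine ⟨gevQuantile γ s, gevQuantile γ t, ?_⟩
  have hs1 := h (gevQuantile γ s)
  have ht1 := (h (gevQuantile γ t)).const_sub 1
  rw [gevCdf_gevQuantile γ hs0] at hs1
  rw [gevCdf_gevQuantile γ ht0] at ht1
  filter_upwards [hs1.eventually (gt_mem_nhds hs), ht1.eventually (gt_mem_nhds ht),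
    eventually_gt_atTop 0] with N h1 h2 hN
  rw [measureReal_topOrderStat_zero_le hN (hY N), measureReal_lt_topOrderStat_zero hN (hY N)]
  linarith

end Scale

/-! ### Joint limits of the noisy order statistics. -/

section NoisyTop

variable {Ω : Type*} [MeasurableSpace Ω] {P : Measure Ω} [IsProbabilityMeasure P]
  {θ : ℕ → Ω → ℝ} {ε : ℕ → ℕ → Ω → ℝ} {p : ℝ} {F : Measure ℝ} {G : ℕ → Measure ℝ}
  {l : Filter (ℕ × ℕ)} {a : ℕ → ℝ}

/-- Under tail equivalence, the noise moves the tail quantiles by `o(a N)`. -/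
lemma eventually_abs_quantile_sub_tailQuantile_le (hl : l ≤ atTop ×ˢ atTop)
    {H : ℕ → Measure ℝ} (hF : HasLaw (θ 0) F P) (hG : ∀ T, HasLaw (ε T 0) (G T) P)
    (hH : ∀ T : ℕ, HasLaw (fun ω => θ 0 ω + 1 / (T : ℝ) ^ p * ε T 0 ω) (H T) P)
    (ha : ∀ N, a N ≠ 0)
    (hsup : ∀ τ : ℝ, 0 < τ → ∃ η : ℝ, η ∈ Set.Ioo (0 : ℝ) 1 ∧
      Tendsto (fun n : ℕ × ℕ => tailSup F (G n.2) (a n.1) p τ η n.1 n.2) l (𝓝 0))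
    (hinf : ∀ τ : ℝ, 0 < τ →
      Tendsto (fun n : ℕ × ℕ => tailInf F (G n.2) (a n.1) p τ n.1 n.2) l (𝓝 0))
    {τ δ : ℝ} (hτ : 0 < τ) (hδ : 0 < δ) :
    ∀ᶠ n in l, |(quantile (H n.2) (1 - 1 / (n.1 * τ))).toReal - tailQuantile F (n.1 * τ)| ≤
      δ * |a n.1| := by
  have hfst : Tendsto Prod.fst l atTop := tendsto_fst.mono_left hl
  have hsnd : Tendsto Prod.snd l atTop := tendsto_snd.mono_left hl
  obtain ⟨η, hη, hsup⟩ := hsup τ hτ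
  have hneg : ((-δ : ℝ) : EReal) < 0 := by exact_mod_cast neg_lt_zero.2 hδ
  have hpos : (0 : EReal) < (δ : ℝ) := by exact_mod_cast hδ
  have hNτ := tendsto_natCast_mul_const_atTop hτ
  -- As η < 1 is fixed, the levels 1 - 1/(Nτ) - u are eventually positive over the whole range of
  -- the supremum, so the F-quantiles there are finite.
  have hη' : ∀ᶠ n in l, η < 1 - 1 / ((n.1 : ℝ) * τ) := by
    have : Tendsto (fun N : ℕ => 1 - 1 / ((N : ℝ) * τ)) atTop (𝓝 (1 - 0)) :=
      tendsto_const_nhds.sub (tendsto_const_nhds.div_atTop hNτ)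
    rw [sub_zero] at this
    exact hfst.eventually (this.eventually (lt_mem_nhds hη.2))
  filter_upwards [hsup.eventually (lt_mem_nhds hneg), hsup.eventually (gt_mem_nhds hpos),
    (hinf τ hτ).eventually (lt_mem_nhds hneg), (hinf τ hτ).eventually (gt_mem_nhds hpos), hη',
    hfst.eventually (hNτ.eventually_gt_atTop 1), hsnd.eventually_gt_atTop 0]
    with n h1 h2 h3 h4 h5 h6 h7
  have e1 := sub_le_quantile_of_tailSup hF (hG n.2) h7 (hH n.2) (ha n.1) h6 hη.1.le h5 h1 h2
  have e2 := quantile_le_add_of_tailInf hF (hG n.2) h7 (hH n.2) (ha n.1) h6 h3 h4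
  rw [abs_le]
  unfold tailQuantile
  constructor <;> linarith

/-- Joint convergence of the largest noisy observations, for normalizing constants which are not of
smaller order than `a N`. -/
theorem tendstoInDistribution_noisyTop {Ω' : Type*} [MeasurableSpace Ω'] {P' : Measure Ω'}
    [IsProbabilityMeasure P'] [l.IsCountablyGenerated] (hl : l ≤ atTop ×ˢ atTop)
    (hindep : ∀ T, iIndepFun (fun i ω => (θ i ω, ε T i ω)) P)
    (hident : ∀ T i,
      IdentDistrib (fun ω => (θ i ω, ε T i ω)) (fun ω => (θ 0 ω, ε T 0 ω)) P P)
    (hF : HasLaw (θ 0) F P) (hG : ∀ T, HasLaw (ε T 0) (G T) P) (ha : ∀ N, a N ≠ 0)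
    (hsup : ∀ τ : ℝ, 0 < τ → ∃ η : ℝ, η ∈ Set.Ioo (0 : ℝ) 1 ∧
      Tendsto (fun n : ℕ × ℕ => tailSup F (G n.2) (a n.1) p τ η n.1 n.2) l (𝓝 0))
    (hinf : ∀ τ : ℝ, 0 < τ →
      Tendsto (fun n : ℕ × ℕ => tailInf F (G n.2) (a n.1) p τ n.1 n.2) l (𝓝 0))
    {A B : ℕ → ℝ} {C : ℝ} (hA : ∀ᶠ N in atTop, |a N| ≤ C * |A N|) {g : ℝ → ℝ} (hg : Measurable g)
    (hlim : ∀ x : ℝ, 0 < x → Tendsto (fun N : ℕ => (tailQuantile F (N * x) - B N) / A N) atTop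
      (𝓝 (g (1 / x))))
    {q : ℕ} {E : Fin (q + 1) → Ω' → ℝ} (hE : ∀ i, HasLaw (E i) (expMeasure 1) P')
    (hE_indep : iIndepFun E P') :
    TendstoInDistribution
      (fun (n : ℕ × ℕ) ω (k : Fin (q + 1)) => (noisyTop θ ε p n.1 n.2 k ω - B n.1) / A n.1)
      l (fun ω k => g (∑ i ∈ Finset.Iic k, E i ω)) (fun _ => P) P' := by
  have hfst : Tendsto Prod.fst l atTop := tendsto_fst.mono_left hl
  let H : ℕ → Measure ℝ := fun T => P.map fun ω => θ 0 ω + 1 / (T : ℝ) ^ p * ε T 0 ω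
  have hmeas : ∀ T : ℕ, Measurable fun z : ℝ × ℝ => z.1 + 1 / (T : ℝ) ^ p * z.2 :=
    fun T => by fun_prop
  have hH : ∀ T : ℕ, HasLaw (fun ω => θ 0 ω + 1 / (T : ℝ) ^ p * ε T 0 ω) (H T) P := fun T =>
    ⟨(hmeas T).comp_aemeasurable (hident T 0).aemeasurable_fst, rfl⟩
  have hHprob : ∀ T, IsProbabilityMeasure (H T) := fun T =>
    (hH T).isProbabilityMeasure_iff.1 inferInstance
  have hHi : ∀ T i : ℕ, HasLaw (fun ω => θ i ω + 1 / (T : ℝ) ^ p * ε T i ω) (H T) P := fun T i => by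
    have h := (hident T i).comp (hmeas T)
    exact ⟨h.aemeasurable_fst, h.map_eq⟩
  have hrow : ∀ n : ℕ × ℕ, HasLaw (fun ω (i : Fin n.1) => θ i ω + 1 / (n.2 : ℝ) ^ p * ε n.2 i ω)
      (Measure.pi fun _ => H n.2) P := fun n =>
    iIndepFun.hasLaw_pi (fun i : Fin n.1 => hHi n.2 i)
      (((hindep n.2).comp (fun _ z => z.1 + 1 / (n.2 : ℝ) ^ p * z.2) fun _ => hmeas n.2).precomp
        Fin.val_injective)
  refine tendstoInDistribution_topOrderStat hfst (fun n => H n.2)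
    (fun n i ω => θ i ω + 1 / (n.2 : ℝ) ^ p * ε n.2 i ω) hrow (A := fun n => A n.1)
    (B := fun n => B n.1) hg (fun v hv => ?_) (iIndepFun.hasLaw_pi hE hE_indep)
  -- Tail equivalence is applied with τ = 1/v, which makes 1 - 1/(Nτ) equal to 1 - v/N.
  have hv' : 0 < 1 / v := one_div_pos.2 hv
  have h1 := (hlim (1 / v) hv').comp hfst
  rw [one_div_one_div] at h1
  have harg : ∀ N : ℕ, 1 - 1 / ((N : ℝ) * (1 / v)) = 1 - v / N := by
    intro N; rw [mul_one_div, one_div_div]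
  have h2 : Tendsto (fun n : ℕ × ℕ => ((quantile (H n.2) (1 - v / n.1)).toReal -
      tailQuantile F (n.1 * (1 / v))) / A n.1) l (𝓝 0) := by
    rw [tendsto_zero_iff_abs_tendsto_zero, Metric.tendsto_nhds]
    intro κ hκ
    have hδ : 0 < κ / (|C| + 1) := by positivity
    filter_upwards [eventually_abs_quantile_sub_tailQuantile_le hl hF hG hH ha hsup hinf hv' hδ,
      hfst.eventually hA] with n h3 h4
    rw [harg] at h3
    simp only [Function.comp_apply, Real.dist_eq, sub_zero, abs_abs, abs_div]
    by_cases hA0 : A n.1 = 0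
    · simpa [hA0] using hκ
    have hA1 : 0 < |A n.1| := abs_pos.2 hA0
    rw [div_lt_iff₀ hA1]
    calc _ ≤ κ / (|C| + 1) * |a n.1| := h3
      _ ≤ κ / (|C| + 1) * (|C| * |A n.1|) := by
        gcongr
        exact h4.trans (by gcongr; exact le_abs_self C)
      _ = κ * |A n.1| * (|C| / (|C| + 1)) := by ring
      _ < κ * |A n.1| * 1 := by
        gcongr
        rw [div_lt_one (by positivity)]; linarith
      _ = κ * |A n.1| := mul_one _
  have h5 := h1.add h2
  rw [add_zero] at h5
  refine h5.congr fun n => ?_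
  simp only [Function.comp_apply]
  rw [← add_div]; ring

end NoisyTop

/-! ### Replacing (α_N, β_N) by the explicit normalizations. -/

section Normalization

variable {F : Measure ℝ} {γ : ℝ} {α β : ℕ → ℝ}

lemma exists_abs_le_mul_abs_of_tendsto_div {a A : ℕ → ℝ} {C κ : ℝ} (hα : ∀ N, 0 < α N)
    (ha : ∀ᶠ N in atTop, |a N| ≤ C * α N) (hκ : 0 < κ)
    (hA : Tendsto (fun N => A N / α N) atTop (𝓝 κ)) :
    ∃ C', ∀ᶠ N in atTop, |a N| ≤ C' * |A N| := by
  refine ⟨|C| / (κ / 2), ?_⟩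
  filter_upwards [ha, hA.eventually (lt_mem_nhds (half_lt_self hκ))] with N h1 h2
  rw [lt_div_iff₀ (hα N)] at h2
  have hκ2 : 0 < κ / 2 := by positivity
  calc |a N| ≤ C * α N := h1
    _ ≤ |C| * α N := by have := (hα N).le; gcongr; exact le_abs_self C
    _ = |C| / (κ / 2) * (κ / 2 * α N) := by field_simp
    _ ≤ |C| / (κ / 2) * |A N| := by gcongr; exact h2.le.trans (le_abs_self _)

lemma gevQuantile_add_one_div (hγ : γ ≠ 0) (x : ℝ) : gevQuantile γ x + 1 / γ = x ^ γ / γ := by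
  rw [gevQuantile, if_neg hγ]; ring

lemma tendsto_tailQuantile_increment_div
    (h : ∀ x : ℝ, 0 < x → Tendsto (fun N : ℕ => (tailQuantile F (N * x) - β N) / α N) atTop
      (𝓝 (gevQuantile γ x))) {x : ℝ} (hx : 0 < x) :
    Tendsto (fun N : ℕ => (tailQuantile F (N * x) - tailQuantile F N) / α N) atTop
      (𝓝 (gevQuantile γ x)) := by
  have := tendsto_tailQuantile_sub_tailQuantile_div h hx one_pos
  simpa [gevQuantile_one] using this

lemma tendsto_tailQuantile_div_tailQuantile (hα : ∀ N, 0 < α N)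
    (h : ∀ x : ℝ, 0 < x → Tendsto (fun N : ℕ => (tailQuantile F (N * x) - β N) / α N) atTop
      (𝓝 (gevQuantile γ x))) (hγ : 0 < γ) {x : ℝ} (hx : 0 < x) :
    Tendsto (fun N : ℕ => tailQuantile F (N * x) / tailQuantile F N) atTop (𝓝 (x ^ γ)) := by
  have h1 := tendsto_tailQuantile_div hα h hγ
  have h2 := ((tendsto_tailQuantile_increment_div h hx).add h1).div h1 (by positivity)
  rw [gevQuantile_add_one_div hγ.ne', div_div_div_cancel_right₀ hγ.ne', div_one] at h2
  refine h2.congr fun N => ?_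
  simp only [Pi.div_apply]
  rw [← add_div, div_div_div_cancel_right₀ (hα N).ne', sub_add_cancel]

lemma tendsto_tailQuantile_sub_quantile_one_div (hα : ∀ N, 0 < α N)
    (h : ∀ x : ℝ, 0 < x → Tendsto (fun N : ℕ => (tailQuantile F (N * x) - β N) / α N) atTop
      (𝓝 (gevQuantile γ x))) (hγ : γ < 0) {x : ℝ} (hx : 0 < x) :
    Tendsto (fun N : ℕ => (tailQuantile F (N * x) - (quantile F 1).toReal) /
      ((quantile F 1).toReal - tailQuantile F N)) atTop (𝓝 (-x ^ γ)) := by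
  have h1 := tendsto_quantile_one_sub_tailQuantile_div hα h hγ
  have hγ' : -1 / γ ≠ 0 := div_ne_zero (by norm_num) hγ.ne
  have h2 := ((tendsto_tailQuantile_increment_div h hx).sub h1).div h1 hγ'
  have hval : (gevQuantile γ x - -1 / γ) / (-1 / γ) = -x ^ γ := by
    rw [neg_div, sub_neg_eq_add, gevQuantile_add_one_div hγ.ne]
    have := hγ.ne
    field_simp
  rw [hval] at h2
  refine h2.congr fun N => ?_
  simp only [Pi.div_apply]
  rw [← sub_div, div_div_div_cancel_right₀ (hα N).ne']
  congr 1
  ring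

/-- The increment U(eN) - U(N) is asymptotic both to α_N and to f(U(N)), because log e = 1; so every
auxiliary function has the scale α_N. -/
lemma tendsto_auxiliaryFunction_div
    (h : ∀ x : ℝ, 0 < x → Tendsto (fun N : ℕ => (tailQuantile F (N * x) - β N) / α N) atTop
      (𝓝 (gevQuantile 0 x))) {f : ℝ → ℝ} (hf : IsAuxiliaryFunction F f) :
    Tendsto (fun N : ℕ => f (tailQuantile F N) / α N) atTop (𝓝 1) := by
  have h1 := tendsto_tailQuantile_increment_div h (Real.exp_pos 1)
  have h2 := hf.2 (Real.exp 1) (Real.exp_pos 1)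
  rw [gevQuantile, if_pos rfl, Real.log_exp] at h1
  rw [Real.log_exp] at h2
  have h3 := h1.div h2 one_ne_zero
  rw [div_one] at h3
  refine h3.congr' ?_
  filter_upwards [h2.eventually (lt_mem_nhds one_pos)] with N hN
  have hf0 := hf.1 (tailQuantile F N)
  have hnum : tailQuantile F (N * Real.exp 1) - tailQuantile F N ≠ 0 := by
    intro h0
    unfold tailQuantile at h0
    rw [h0, zero_div] at hN
    exact lt_irrefl _ hN
  simp only [Pi.div_apply]
  change (tailQuantile F (N * Real.exp 1) - tailQuantile F N) / α N /
    ((tailQuantile F (N * Real.exp 1) - tailQuantile F N) / f (tailQuantile F N)) = _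
  rw [div_div_div_eq, mul_comm (α N), mul_div_mul_left _ _ hnum]

end Normalization

theorem lemma2
    {Ω Ω' Ω'' : Type*} [MeasurableSpace Ω] [MeasurableSpace Ω'] [MeasurableSpace Ω'']
    (P : Measure Ω) [IsProbabilityMeasure P]
    (P' : Measure Ω') [IsProbabilityMeasure P']
    (P'' : Measure Ω'') [IsProbabilityMeasure P'']
    -- latent heterogeneity `θ i` and scaled estimation errors `ε T i`
    (θ : ℕ → Ω → ℝ) (ε : ℕ → ℕ → Ω → ℝ) (p : ℝ) (hp : 0 < p)
    (hindep : ∀ T, iIndepFun (fun i ω => (θ i ω, ε T i ω)) P)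
    (hident : ∀ T i,
      IdentDistrib (fun ω => (θ i ω, ε T i ω)) (fun ω => (θ 0 ω, ε T 0 ω)) P P)
    (F : Measure ℝ) (hF : HasLaw (θ 0) F P)
    (G : ℕ → Measure ℝ) (hG : ∀ T, HasLaw (ε T 0) (G T) P)
    -- the mode in which `N, T → ∞`
    (l : Filter (ℕ × ℕ)) [l.IsCountablyGenerated] (hl : l ≤ atTop ×ˢ atTop)
    -- nondegenerate limit of the normalized noiseless maximum
    (a b : ℕ → ℝ) (ha : ∀ N, a N ≠ 0) (X : Ω' → ℝ)
    (hX : TendstoInDistribution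
      (fun N ω => (topOrderStat N (fun i : Fin N => θ i ω) 0 - b N) / a N) atTop X
      (fun _ => P) P')
    (hX_nondeg : ¬ ∃ c : ℝ, ∀ᵐ ω ∂P', X ω = c)
    -- tail equivalence conditions
    (hsup : ∀ τ : ℝ, 0 < τ → ∃ η : ℝ, η ∈ Set.Ioo (0 : ℝ) 1 ∧
      Tendsto (fun n : ℕ × ℕ => tailSup F (G n.2) (a n.1) p τ η n.1 n.2) l (𝓝 0))
    (hinf : ∀ τ : ℝ, 0 < τ →
      Tendsto (fun n : ℕ × ℕ => tailInf F (G n.2) (a n.1) p τ n.1 n.2) l (𝓝 0))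
    (γ : ℝ) (hγ : InDomainOfAttraction F γ)
    -- independent standard exponential variables
    (q : ℕ) (E : Fin (q + 1) → Ω'' → ℝ)
    (hE : ∀ i, HasLaw (E i) (expMeasure 1) P'') (hE_indep : iIndepFun E P'') :
    (0 < γ →
      TendstoInDistribution
        (fun (n : ℕ × ℕ) ω (k : Fin (q + 1)) =>
          noisyTop θ ε p n.1 n.2 k ω / (quantile F (1 - 1 / n.1)).toReal)
        l (fun ω (k : Fin (q + 1)) => (∑ i ∈ Finset.Iic k, E i ω) ^ (-γ))
        (fun _ => P) P'') ∧
    (γ = 0 →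
      (∃ f : ℝ → ℝ, IsAuxiliaryFunction F f) ∧
      ∀ f : ℝ → ℝ, IsAuxiliaryFunction F f →
        TendstoInDistribution
          (fun (n : ℕ × ℕ) ω (k : Fin (q + 1)) =>
            (noisyTop θ ε p n.1 n.2 k ω - (quantile F (1 - 1 / n.1)).toReal) /
              f (quantile F (1 - 1 / n.1)).toReal)
          l (fun ω (k : Fin (q + 1)) => -Real.log (∑ i ∈ Finset.Iic k, E i ω))
          (fun _ => P) P'') ∧
    (γ < 0 →
      quantile F 1 < ⊤ ∧
      TendstoInDistribution
        (fun (n : ℕ × ℕ) ω (k : Fin (q + 1)) =>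
          (noisyTop θ ε p n.1 n.2 k ω - (quantile F 1).toReal) /
            ((quantile F 1).toReal - (quantile F (1 - 1 / n.1)).toReal))
        l (fun ω (k : Fin (q + 1)) => -(∑ i ∈ Finset.Iic k, E i ω) ^ (-γ))
        (fun _ => P) P'') := by
  have hFprob : IsProbabilityMeasure F := hF.isProbabilityMeasure_iff.1 inferInstance
  obtain ⟨α, β, hα, hdom⟩ := hγ
  have hU : ∀ x : ℝ, 0 < x → Tendsto (fun N : ℕ => (tailQuantile F (N * x) - β N) / α N) atTop
      (𝓝 (gevQuantile γ x)) := fun x hx => tendsto_tailQuantile_sub_div hα hdom hx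
  have hθ : ∀ N : ℕ, HasLaw (fun ω (i : Fin N) => θ i ω) (Measure.pi fun _ => F) P := by
    intro N
    have hlaw : ∀ i, HasLaw (θ i) F P := fun i => by
      have h := (hident 0 i).comp measurable_fst
      exact ⟨h.aemeasurable_fst, h.map_eq.trans hF.map_eq⟩
    exact iIndepFun.hasLaw_pi (fun i : Fin N => hlaw i)
      (((hindep 0).comp (fun _ => Prod.fst) fun _ => measurable_fst).precomp Fin.val_injective)
  -- The constants a_N and the limit X matter only through a_N = O(α_N), which makes an o(a_N) noise
  -- effect negligible in each of the three scales.
  obtain ⟨C, hC⟩ := exists_abs_le_mul_of_tendstoInDistribution ha hX hX_nondeg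
    fun ρ hρ => tight_topOrderStat_zero hθ hdom hρ
  refine ⟨fun hγ => ?_, fun hγ => ⟨?_, fun f hf => ?_⟩, fun hγ => ⟨?_, ?_⟩⟩
  · obtain ⟨C', hC'⟩ := exists_abs_le_mul_abs_of_tendsto_div hα hC (one_div_pos.2 hγ)
      (tendsto_tailQuantile_div hα hU hγ)
    have hmain := tendstoInDistribution_noisyTop hl hindep hident hF hG ha hsup hinf
      (A := fun N => tailQuantile F N) (B := fun _ => 0) hC' (g := fun v => v ^ (-γ))
      (by fun_prop) (fun x hx => ?_) hE hE_indep
    · simp only [sub_zero] at hmain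
      exact hmain
    · have h := tendsto_tailQuantile_div_tailQuantile hα hU hγ hx
      rw [one_div, Real.inv_rpow hx.le, Real.rpow_neg hx.le, inv_inv]
      simpa only [sub_zero] using h
  · subst hγ
    exact exists_isAuxiliaryFunction hα hU
  · subst hγ
    obtain ⟨C', hC'⟩ := exists_abs_le_mul_abs_of_tendsto_div hα hC one_pos
      (tendsto_auxiliaryFunction_div hU hf)
    refine tendstoInDistribution_noisyTop hl hindep hident hF hG ha hsup hinf
      (A := fun N => f (tailQuantile F N)) (B := fun N => tailQuantile F N) hC'
      (g := fun v => -Real.log v) (by fun_prop) (fun x hx => ?_) hE hE_indep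
    rw [one_div, Real.log_inv, neg_neg]
    exact hf.2 x hx
  · exact quantile_one_lt_top_of_neg hα hU hγ
  · obtain ⟨C', hC'⟩ := exists_abs_le_mul_abs_of_tendsto_div hα hC
      (div_pos_of_neg_of_neg (by norm_num) hγ) (tendsto_quantile_one_sub_tailQuantile_div hα hU hγ)
    refine tendstoInDistribution_noisyTop hl hindep hident hF hG ha hsup hinf
      (A := fun N => (quantile F 1).toReal - tailQuantile F N)
      (B := fun _ => (quantile F 1).toReal) hC' (g := fun v => -v ^ (-γ))
      (by fun_prop) (fun x hx => ?_) hE hE_indep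
    rw [one_div, Real.inv_rpow hx.le, Real.rpow_neg hx.le, inv_inv]
    exact tendsto_tailQuantile_sub_quantile_one_div hα hU hγ hx
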